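/- Let $H$ be a separable complex Hilbert space, $\mathcal B(H)$ the space of bounded linear operators on $H$, and $1<p<\infty$. Let $L^p(\mathcal B)$ be the Schatten $p$-class, i.e. the set of compact operators $A\in\mathcal B(H)$ with $\|A\|_p:=(\operatorname{tr}|A|^p)^{1/p}<\infty$, where $|A|=\sqrt{A^*A}$. For $A,B\in\mathcal B(H)$ write $A\le B$ if $B-A$ is self-adjoint and $((B-A)x,x)\ge 0$ for all $x\in H$. An \emph{ordered gradient space} $(V,\widetilde V,W,\widetilde W,R)$ consists of (real or complex) vector spaces $\widetilde V,\widetilde W$, linear subspaces $V\subseteq\widetilde V$, $W\subseteq\widetilde W$ equipped with norms, a relation $R\subseteq\widetilde V\times\widetilde W$, and a relation $\le$ on $\widetilde V$ such that: (1) $R$ is closed under addition and under multiplication by scalars $\alpha>0$; (2) $V$ and $W$ are reflexive and strictly convex Banach spaces; (3) if $(u,g)\in R$ with $u\in V$, $g\in W$, then $(-u,g')\in R$ for some $g'\in W$; (4) if $u,u_i\in V$, $g,g_i\in W$, $(u_i,g_i)\in R$ for $i=1,2,\dots$, $\|u-u_i\|_V\to0$ and $\|g-g_i\|_W\to 0$,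 then $(u,g)\in R$; (5) $\le$ is a linear preorder: it is reflexive and transitive, $b\le c$ implies $a+b\le a+c$, and $a\le b$ implies $\alpha a\le\alpha b$ for all real $\alpha\ge0$; (6) if $u,u_i\in V$, $\psi\in\widetilde V$, $u_i\le\psi$ for $i=1,2,\dots$ and $\|u-u_i\|_V\to0$, then $u\le\psi$; (7) if $u,v\in V$ and $0\le u\le v$, then $\|u\|_V\le\|v\|_V$. \textbf{Theorem.} Let $D\subseteq L^p(\mathcal B)$ be a linear subspace that is closed with respect to $\|\cdot\|_p$, and let $T:D\to L^p(\mathcal B)$ be a bounded linear map, i.e. a linear map for which there is $C>0$ with $\|T(A)\|_p\le C\|A\|_p$ for all $A\in D$. Put $R_T=\{(A,T(A)):A\in D\}$. Then $$\bigl(L^p(\mathcal B),\mathcal B(H),L^p(\mathcal B),\mathcal B(H),R_T\bigr),$$ with the norm $\|\cdot\|_p$ on $L^p(\mathcal B)$ and the operator order $\le$ on $\mathcal B(H)$, is an ordered gradient space. -/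

import Mathlib

open Filter Topology
open scoped ENNReal

/-! ### Normed linear subspaces of a vector space -/

namespace GradSp

/-- `V` is a linear subspace of the vector space `E`, and `N`, restricted to `V`, is a norm on it.
The values of `N` outside `V` are irrelevant. -/
structure IsNormedSubspace (𝕜 : Type*) {E : Type*} [RCLike 𝕜] [AddCommGroup E] [Module 𝕜 E]
    (V : Set E) (N : E → ℝ) : Prop where
  zero_mem : (0 : E) ∈ V
  add_mem : ∀ {u v : E}, u ∈ V → v ∈ V → u + v ∈ V
  smul_mem : ∀ (c : 𝕜) {u : E}, u ∈ V → c • u ∈ V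
  nonneg : ∀ u ∈ V, 0 ≤ N u
  eq_zero_iff : ∀ u ∈ V, N u = 0 ↔ u = 0
  norm_smul : ∀ (c : 𝕜), ∀ u ∈ V, N (c • u) = ‖c‖ * N u
  norm_add_le : ∀ u ∈ V, ∀ v ∈ V, N (u + v) ≤ N u + N v

namespace IsNormedSubspace

variable {𝕜 E : Type*} [RCLike 𝕜] [AddCommGroup E] [Module 𝕜 E] {V : Set E} {N : E → ℝ}

/-- `V` as a submodule of `E`. -/
def toSubmodule (h : IsNormedSubspace 𝕜 V N) : Submodule 𝕜 E where
  carrier := V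
  add_mem' := h.add_mem
  zero_mem' := h.zero_mem
  smul_mem' := fun c _ hu => h.smul_mem c hu

/-- `V` as a vector space of its own, which below carries the norm `N` (and not a norm
inherited from `E`, in case that `E` is itself a normed space). -/
def Space (h : IsNormedSubspace 𝕜 V N) : Type _ := ↥h.toSubmodule

/-- The inclusion of `V` in `E`. -/
def incl (h : IsNormedSubspace 𝕜 V N) (u : h.Space) : E := h.toSubmodule.subtype u

instance (h : IsNormedSubspace 𝕜 V N) : AddCommGroup h.Space :=
  inferInstanceAs (AddCommGroup ↥h.toSubmodule)

instance (h : IsNormedSubspace 𝕜 V N) : Module 𝕜 h.Space :=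
  inferInstanceAs (Module 𝕜 ↥h.toSubmodule)

instance (h : IsNormedSubspace 𝕜 V N) : Norm h.Space := ⟨fun u => N (h.incl u)⟩

theorem core (h : IsNormedSubspace 𝕜 V N) : NormedSpace.Core 𝕜 h.Space where
  norm_nonneg u := h.nonneg u.1 u.2
  norm_smul c u := h.norm_smul c u.1 u.2
  norm_triangle u v := h.norm_add_le u.1 u.2 v.1 v.2
  norm_eq_zero_iff u := (h.eq_zero_iff u.1 u.2).trans
    ⟨fun e => Subtype.ext e, fun e => congrArg Subtype.val e⟩

noncomputable instance (h : IsNormedSubspace 𝕜 V N) : NormedAddCommGroup h.Space :=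
  NormedAddCommGroup.ofCore h.core

noncomputable instance (h : IsNormedSubspace 𝕜 V N) : NormedSpace 𝕜 h.Space :=
  NormedSpace.ofCore h.core

end IsNormedSubspace

/-- A normed space is reflexive if its canonical map into its double dual is onto. -/
def IsReflexiveSpace (𝕜 X : Type*) [RCLike 𝕜] [NormedAddCommGroup X] [NormedSpace 𝕜 X] : Prop :=
  Function.Surjective (NormedSpace.inclusionInDoubleDual 𝕜 X)

/-- The linear subspace `V` of `E` is, with the norm `N`, a reflexive Banach space. -/
def IsReflexiveBanach (𝕜 : Type*) {E : Type*} [RCLike 𝕜] [AddCommGroup E] [Module 𝕜 E]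
    (V : Set E) (N : E → ℝ) : Prop :=
  ∃ h : IsNormedSubspace 𝕜 V N, CompleteSpace h.Space ∧ IsReflexiveSpace 𝕜 h.Space

/-- The linear subspace `V` of `E` is, with the norm `N`, a strictly convex normed space. -/
def IsStrictlyConvex (𝕜 : Type*) {E : Type*} [RCLike 𝕜] [AddCommGroup E] [Module 𝕜 E]
    (V : Set E) (N : E → ℝ) : Prop :=
  ∃ h : IsNormedSubspace 𝕜 V N,
    letI : NormedSpace ℝ h.Space := NormedSpace.restrictScalars ℝ 𝕜 h.Space
    StrictConvexSpace ℝ h.Space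

/-! ### Gradient spaces -/

/-- Gradient relations between a `𝕜₁`-vector space `E` and a `𝕜₂`-vector space `F`;
`(u, g) ∈ R` means that `g` is a gradient of `u`. -/
structure IsGradientRelation (𝕜₁ 𝕜₂ : Type*) {E F : Type*} [RCLike 𝕜₁] [RCLike 𝕜₂]
    [AddCommGroup E] [Module 𝕜₁ E] [AddCommGroup F] [Module 𝕜₂ F] (R : Set (E × F)) : Prop where
  add_mem : ∀ (u u' : E) (g g' : F), (u, g) ∈ R → (u', g') ∈ R → (u + u', g + g') ∈ R
  smul_mem : ∀ (u : E) (g : F) (α : ℝ), 0 < α → (u, g) ∈ R → ((α : 𝕜₁) • u, (α : 𝕜₂) • g) ∈ R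

/-- `(V, E, W, F, R)` is a gradient space, where the subspaces `V ⊆ E` and `W ⊆ F` carry the
norms `NV` and `NW`. -/
structure IsGradientSpace (𝕜₁ 𝕜₂ : Type*) {E F : Type*} [RCLike 𝕜₁] [RCLike 𝕜₂]
    [AddCommGroup E] [Module 𝕜₁ E] [AddCommGroup F] [Module 𝕜₂ F]
    (V : Set E) (NV : E → ℝ) (W : Set F) (NW : F → ℝ) (R : Set (E × F)) : Prop where
  gradientRelation : IsGradientRelation 𝕜₁ 𝕜₂ R
  reflexive_left : IsReflexiveBanach 𝕜₁ V NV
  reflexive_right : IsReflexiveBanach 𝕜₂ W NW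
  strictlyConvex_right : IsStrictlyConvex 𝕜₂ W NW
  neg_gradient : ∀ u ∈ V, ∀ g ∈ W, (u, g) ∈ R → ∃ g' ∈ W, (-u, g') ∈ R
  closed : ∀ (u : E) (us : ℕ → E) (g : F) (gs : ℕ → F),
    u ∈ V → (∀ i, us i ∈ V) → g ∈ W → (∀ i, gs i ∈ W) → (∀ i, (us i, gs i) ∈ R) →
    Tendsto (fun i => NV (u - us i)) atTop (𝓝 0) →
    Tendsto (fun i => NW (g - gs i)) atTop (𝓝 0) → (u, g) ∈ R

/-- Linear preorders on a vector space; antisymmetry is not required. -/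
structure IsLinearPreorder (𝕜 : Type*) {E : Type*} [RCLike 𝕜] [AddCommGroup E] [Module 𝕜 E]
    (le : E → E → Prop) : Prop where
  refl : ∀ a, le a a
  trans : ∀ a b c, le a b → le b c → le a c
  add_left : ∀ a b c, le b c → le (a + b) (a + c)
  smul : ∀ (a b : E) (α : ℝ), 0 ≤ α → le a b → le ((α : 𝕜) • a) ((α : 𝕜) • b)

/-- `(V, E, W, F, R)` is, with the relation `le` on `E`, a preordered gradient space. -/
structure IsPreorderedGradientSpace (𝕜₁ 𝕜₂ : Type*) {E F : Type*} [RCLike 𝕜₁] [RCLike 𝕜₂]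
    [AddCommGroup E] [Module 𝕜₁ E] [AddCommGroup F] [Module 𝕜₂ F]
    (V : Set E) (NV : E → ℝ) (W : Set F) (NW : F → ℝ) (R : Set (E × F)) (le : E → E → Prop) :
    Prop extends IsGradientSpace 𝕜₁ 𝕜₂ V NV W NW R where
  linearPreorder : IsLinearPreorder 𝕜₁ le
  le_of_tendsto : ∀ (u : E) (us : ℕ → E) (ψ : E), u ∈ V → (∀ i, us i ∈ V) →
    (∀ i, le (us i) ψ) → Tendsto (fun i => NV (u - us i)) atTop (𝓝 0) → le u ψ

/-- `(V, E, W, F, R)` is, with the relation `le` on `E`, an ordered gradient space. -/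
structure IsOrderedGradientSpace (𝕜₁ 𝕜₂ : Type*) {E F : Type*} [RCLike 𝕜₁] [RCLike 𝕜₂]
    [AddCommGroup E] [Module 𝕜₁ E] [AddCommGroup F] [Module 𝕜₂ F]
    (V : Set E) (NV : E → ℝ) (W : Set F) (NW : F → ℝ) (R : Set (E × F)) (le : E → E → Prop) :
    Prop extends IsPreorderedGradientSpace 𝕜₁ 𝕜₂ V NV W NW R le where
  strictlyConvex_left : IsStrictlyConvex 𝕜₁ V NV
  norm_mono : ∀ u ∈ V, ∀ v ∈ V, le 0 u → le u v → NV u ≤ NV v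

/-! ### Schatten classes -/

section Schatten

variable {H : Type*} [NormedAddCommGroup H] [InnerProductSpace ℂ H] [CompleteSpace H]

/-- The trace `∑ₖ ⟪P eₖ, eₖ⟫ ∈ [0, ∞]` of a positive operator `P`, where `(eₖ)` is an orthonormal
basis of `H`; see `opTrace_eq` for the independence of the basis. -/
noncomputable def opTrace (P : H →L[ℂ] H) : ℝ≥0∞ :=
  ∑' k, ENNReal.ofReal
    (P.reApplyInnerSelf ((exists_hilbertBasis ℂ H).choose_spec.choose k))

theorem tsum_sq_norm_inner {H : Type*} [NormedAddCommGroup H] [InnerProductSpace ℂ H]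
    {ι : Type*} (b : HilbertBasis ι ℂ H) (x : H) :
    ∑' i, ENNReal.ofReal (‖inner ℂ (b i) x‖ ^ 2) = ENNReal.ofReal (‖x‖ ^ 2) := by
  have h := b.hasSum_inner_mul_inner x x
  have h2 : HasSum (fun i => ‖inner ℂ (b i) x‖ ^ 2) (‖x‖ ^ 2) := by
    have h3 := Complex.hasSum_re h
    convert h3 using 1
    · ext i
      rw [← inner_conj_symm x (b i), mul_comm, Complex.mul_conj, Complex.normSq_eq_norm_sq]
      exact (Complex.ofReal_re _).symm
    · exact (inner_self_eq_norm_sq (𝕜 := ℂ) x).symm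
  rw [← h2.tsum_eq, ENNReal.ofReal_tsum_of_nonneg (fun _ => by positivity) h2.summable]

theorem tsum_reApplyInnerSelf {ι κ : Type*} (b : HilbertBasis ι ℂ H) (b' : HilbertBasis κ ℂ H)
    {P : H →L[ℂ] H} (hP : 0 ≤ P) :
    ∑' i, ENNReal.ofReal (P.reApplyInnerSelf (b i)) =
      ∑' j, ENNReal.ofReal (P.reApplyInnerSelf (b' j)) := by
  set S := CFC.sqrt P
  have hS : S * S = P := CFC.sqrt_mul_sqrt_self P hP
  have hSs : IsSelfAdjoint S := IsSelfAdjoint.of_nonneg (CFC.sqrt_nonneg P)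
  have hsymm : ∀ x y, inner ℂ (S x) y = inner ℂ x (S y) :=
    ContinuousLinearMap.isSelfAdjoint_iff_isSymmetric.mp hSs
  have key : ∀ x, P.reApplyInnerSelf x = ‖S x‖ ^ 2 := by
    intro x
    rw [ContinuousLinearMap.reApplyInnerSelf_apply, ← hS, mul_apply_eq_comp, hsymm,
      inner_self_eq_norm_sq]
  simp_rw [key]
  simp_rw [← tsum_sq_norm_inner b (S (b' _)), ← tsum_sq_norm_inner b' (S (b _))]
  rw [ENNReal.tsum_comm]
  refine tsum_congr fun j => tsum_congr fun i => ?_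
  rw [← hsymm, norm_inner_symm]

/-- The trace of a positive operator does not depend on the orthonormal basis. -/
theorem opTrace_eq {ι : Type*} (b : HilbertBasis ι ℂ H) {P : H →L[ℂ] H} (hP : 0 ≤ P) :
    opTrace P = ∑' i, ENNReal.ofReal (P.reApplyInnerSelf (b i)) :=
  tsum_reApplyInnerSelf _ b hP

/-- `tr (|A| ^ p)`, with `|A| = √(A⋆ A)` and the power formed in the continuous functional
calculus. -/
noncomputable def traceAbsPow (p : ℝ) (A : H →L[ℂ] H) : ℝ≥0∞ :=
  opTrace (CFC.abs A ^ p)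

/-- The Schatten class `L^p(𝓑)`: the compact operators `A` on `H` with `tr (|A| ^ p) < ∞`. -/
def schattenClass (H : Type*) [NormedAddCommGroup H] [InnerProductSpace ℂ H] [CompleteSpace H]
    (p : ℝ) : Set (H →L[ℂ] H) :=
  {A | IsCompactOperator A ∧ traceAbsPow p A ≠ ∞}

/-- The Schatten norm `‖A‖ₚ = (tr (|A| ^ p)) ^ (1 / p)` of an operator `A ∈ L^p(𝓑)`. -/
noncomputable def schattenNorm (p : ℝ) (A : H →L[ℂ] H) : ℝ :=
  (traceAbsPow p A).toReal ^ (1 / p)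

/-- The relation `{(A, T A) : A ∈ D}` between operators. -/
def graphRel (D : Submodule ℂ (H →L[ℂ] H)) (T : D →ₗ[ℂ] (H →L[ℂ] H)) :
    Set ((H →L[ℂ] H) × (H →L[ℂ] H)) :=
  Set.range fun A : D => ((A : H →L[ℂ] H), T A)

end Schatten

end GradSp

/-! Everything rests on a variational description of the Schatten norm: `schattenNorm p A` is the
least `C ≥ 0` such that every finite diagonal `⟪yⱼ, A xⱼ⟫`, taken along Bessel families, has
`ℓ^p`-norm at most `C` (`SchattenBound`). That the norm is such a bound follows from the singular
value decomposition and a Jensen inequality with doubly substochastic weights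
(`IsSVD.sum_rpow_add_le`). That no smaller bound exists is seen by testing on the singular vectors
of `A`. A finite bound also forces compactness, so membership in the class can be checked on
diagonals alone.

Properties of `ℓ^p` then pass to operators. Minkowski gives the triangle inequality; the bound
survives operator-norm limits, which gives completeness; and for `0 ≤ A ≤ B`, the diagonal of `B` in
an eigenbasis of `A` dominates the eigenvalues of `A`.

For strict convexity, Jensen is kept with its defect `tangentGap`. If `A`, `B` have norm one and `A
+ B` has norm two, their diagonals along the singular vectors of `A + B` agree by strict convexity
of `ℓ^p`. They also exhaust the norms of `A` and `B`, so the defect vanishes and both operators are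
determined by this common diagonal (`IsSVD.apply_eq_inner_smul`).

Reflexivity is trace duality between the exponents `p` and `q`. A bounded functional is represented
by an operator with a Schatten bound for the conjugate exponent (`exists_operator_of_dual`). Applied
twice, this turns an element of the bidual into an operator of the class. Convergence of truncated
decompositions shows that the matrix-entry functionals span a dense subspace of the dual, where it
suffices to compare.

The gradient axioms need only linearity of `T`, closedness of `D`, the bound on `T`, and the fact
that the Schatten norm dominates the operator norm. -/

namespace GradSp

/-! ### Bessel families -/

section Bessel

variable {H : Type*} [NormedAddCommGroup H] [InnerProductSpace ℂ H]

/-- Families that satisfy Bessel's inequality. -/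
def IsBessel {ι : Type*} (v : ι → H) : Prop :=
  ∀ (s : Finset ι) (y : H), ∑ i ∈ s, ‖inner ℂ (v i) y‖ ^ 2 ≤ ‖y‖ ^ 2

variable {ι κ : Type*} {v : ι → H}

theorem _root_.Orthonormal.isBessel (hv : Orthonormal ℂ v) : IsBessel v :=
  fun _ y => hv.sum_inner_products_le y

theorem IsBessel.comp (hv : IsBessel v) {f : κ → ι} (hf : Function.Injective f) :
    IsBessel (v ∘ f) := fun s y => by
  have := hv (s.map ⟨f, hf⟩) y
  rwa [Finset.sum_map] at this

theorem IsBessel.norm_le_one (hv : IsBessel v) (i : ι) : ‖v i‖ ≤ 1 := by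
  have h := hv {i} (v i)
  rw [Finset.sum_singleton, inner_self_eq_norm_sq_to_K] at h
  simp only [norm_pow, Complex.coe_algebraMap, Complex.norm_real, norm_norm] at h
  by_contra! h1
  have h2 : 1 < ‖v i‖ ^ 2 := one_lt_pow₀ h1 two_ne_zero
  nlinarith

theorem IsBessel.summable (hv : IsBessel v) (y : H) :
    Summable fun i => ‖inner ℂ (v i) y‖ ^ 2 :=
  summable_of_sum_le (fun _ => by positivity) fun s => hv s y

theorem IsBessel.tsum_le (hv : IsBessel v) (y : H) : ∑' i, ‖inner ℂ (v i) y‖ ^ 2 ≤ ‖y‖ ^ 2 :=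
  (hv.summable y).tsum_le_of_sum_le fun s => hv s y

/-- An orthogonal family of vectors of norm `0` or `1` satisfies Bessel's inequality. -/
theorem isBessel_of_orthogonal (h : ∀ i j, i ≠ j → inner ℂ (v i) (v j) = 0)
    (h1 : ∀ i, v i ≠ 0 → ‖v i‖ = 1) : IsBessel v := by
  classical
  intro s y
  have ho : Orthonormal ℂ (fun i : {i // v i ≠ 0} => v i) :=
    ⟨fun i => h1 i i.2, fun i j hij => h i j (Subtype.coe_injective.ne hij)⟩
  have := ho.isBessel (s.subtype _) y
  rw [Finset.sum_subtype_eq_sum_filter (f := fun i => ‖inner ℂ (v i) y‖ ^ 2)] at this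
  refine le_trans (le_of_eq ?_) this
  refine (Finset.sum_filter_of_ne (p := fun i => v i ≠ 0) fun i _ hi h0 => hi ?_).symm
  simp [h0]

end Bessel

/-! ### Tangents of the power function -/

section Tangent

/-- The distance at `a` of the graph of `t ↦ t ^ p` from its tangent at `d`. -/
noncomputable def tangentGap (p a d : ℝ) : ℝ := a ^ p - p * d ^ (p - 1) * a + (p - 1) * d ^ p

/-- For `d > 0` this is Bernoulli's strict inequality at `a / d - 1`, scaled by `d ^ p`; at `d = 0`
only the term `a ^ p` survives. -/
theorem tangentGap_pos {p a d : ℝ} (hp : 1 < p) (ha : 0 ≤ a) (hd : 0 ≤ d) (had : a ≠ d) :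
    0 < tangentGap p a d := by
  unfold tangentGap
  rcases hd.eq_or_lt with rfl | hd
  · have : 0 < a := ha.lt_of_ne' had
    rw [Real.zero_rpow (by linarith), Real.zero_rpow (by linarith)]
    simp only [mul_zero, zero_mul, sub_zero, add_zero]
    positivity
  · have h := one_add_mul_self_lt_rpow_one_add (s := a / d - 1) (p := p)
      (by have : 0 ≤ a / d := by positivity
          linarith) (by rw [sub_ne_zero, ne_eq, div_eq_one_iff_eq hd.ne']; exact had) hp
    rw [add_sub_cancel, Real.div_rpow ha hd.le] at h
    have hdp : 0 < d ^ p := by positivity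
    have h2 := mul_lt_mul_of_pos_right h hdp
    rw [div_mul_cancel₀ _ hdp.ne'] at h2
    have h3 : d ^ p = d ^ (p - 1) * d := by
      rw [← Real.rpow_add_one hd.ne']; ring_nf
    have h4 : (1 + p * (a / d - 1)) * d ^ p = p * d ^ (p - 1) * a - (p - 1) * d ^ p := by
      rw [h3]; field_simp; ring
    linarith

theorem tangentGap_nonneg {p a d : ℝ} (hp : 1 < p) (ha : 0 ≤ a) (hd : 0 ≤ d) :
    0 ≤ tangentGap p a d := by
  by_cases had : a = d
  · subst had
    unfold tangentGap
    rcases hd.eq_or_lt with rfl | hd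
    · simp [Real.zero_rpow (by linarith : p ≠ 0)]
    · have h3 : a ^ p = a ^ (p - 1) * a := by
        rw [← Real.rpow_add_one hd.ne']; ring_nf
      rw [h3]; apply le_of_eq; ring
  · exact (tangentGap_pos hp ha hd had).le

/-- A quantitative form of Jensen's inequality for `t ↦ t ^ p` and a discrete measure `m` of mass
at most one. -/
theorem rpow_add_sum_tangentGap_le {ι : Type*} {p d : ℝ} (hp : 1 < p) {a m : ι → ℝ}
    (ha : ∀ i, 0 ≤ a i) (hm : ∀ i, 0 ≤ m i) (hd : 0 ≤ d) (hms : Summable m)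
    (hm1 : ∑' i, m i ≤ 1) (has : Summable fun i => a i * m i)
    (haps : Summable fun i => a i ^ p * m i) (hda : d ≤ ∑' i, a i * m i) (I : Finset ι) :
    d ^ p + ∑ i ∈ I, tangentGap p (a i) d * m i ≤ ∑' i, a i ^ p * m i := by
  have e : (fun i => tangentGap p (a i) d * m i) = fun i =>
      a i ^ p * m i - p * d ^ (p - 1) * (a i * m i) + (p - 1) * d ^ p * m i := by
    ext i; unfold tangentGap; ring
  have hs1 := haps.sub (has.mul_left (p * d ^ (p - 1)))
  have hs2 := hms.mul_left ((p - 1) * d ^ p)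
  have hS : Summable fun i => tangentGap p (a i) d * m i := by
    rw [e]; exact hs1.add hs2
  have h1 := hS.sum_le_tsum I fun i _ => mul_nonneg (tangentGap_nonneg hp (ha i) hd) (hm i)
  have h2 : ∑' i, tangentGap p (a i) d * m i = ∑' i, a i ^ p * m i
      - p * d ^ (p - 1) * ∑' i, a i * m i + (p - 1) * d ^ p * ∑' i, m i := by
    rw [e, hs1.tsum_add hs2, haps.tsum_sub (has.mul_left _), tsum_mul_left, tsum_mul_left]
  have h3 : d ^ p = d ^ (p - 1) * d := by
    rcases hd.eq_or_lt with rfl | hd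
    · simp [Real.zero_rpow (by linarith : p ≠ 0)]
    · rw [← Real.rpow_add_one hd.ne']; ring_nf
  have h4 : 0 ≤ d ^ (p - 1) := by positivity
  have h5 : 0 ≤ d ^ p := by positivity
  -- Both one-sided hypotheses, on the mean and on the mass, act in the favourable direction because
  -- the tangent's slope and `(p - 1) * d ^ p` are nonnegative. What remains is `-p * d ^ p + (p -
  -- 1) * d ^ p = -d ^ p`.
  have h6 := mul_le_mul_of_nonneg_left hda (by positivity : 0 ≤ p * d ^ (p - 1))
  have h7 := mul_le_mul_of_nonneg_left hm1 (mul_nonneg (by linarith : 0 ≤ p - 1) h5)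
  have h8 : p * d ^ (p - 1) * d = p * d ^ p := by rw [h3]; ring
  linarith

end Tangent

/-! ### Singular value decompositions -/

section SVD

variable {H : Type*} [NormedAddCommGroup H] [InnerProductSpace ℂ H]

/-- `A = ∑ᵢ aᵢ ⟪uᵢ, ·⟫ vᵢ`, where `aᵢ ≥ 0` and `u`, `v` are Bessel families. -/
structure IsSVD {ι : Type*} (A : H →L[ℂ] H) (u v : ι → H) (a : ι → ℝ) : Prop where
  left : IsBessel u
  right : IsBessel v
  nonneg : ∀ i, 0 ≤ a i
  hasSum : ∀ x, HasSum (fun i => ((a i : ℂ) * inner ℂ (u i) x) • v i) (A x)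

variable {ι κ : Type*} {A : H →L[ℂ] H} {u v : ι → H} {a : ι → ℝ} {p : ℝ}

theorem le_tsum_rpow_rpow (hp : 1 < p) (ha : ∀ i, 0 ≤ a i) (hs : Summable fun i => a i ^ p)
    (i : ι) : a i ≤ (∑' i, a i ^ p) ^ (1 / p) := by
  have h : a i ^ p ≤ ∑' i, a i ^ p :=
    hs.le_tsum i fun j _ => Real.rpow_nonneg (ha j) _
  have h2 := Real.rpow_le_rpow (Real.rpow_nonneg (ha i) p) h (z := 1 / p) (by positivity)
  rwa [← Real.rpow_mul (ha i), mul_one_div_cancel (by linarith), Real.rpow_one] at h2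

/-- The weights `m j i`, averages of squared coefficients, have row and column sums at most one by
Bessel's inequality, and AM-GM bounds each diagonal entry by `∑ᵢ aᵢ m j i`. Jensen in each row and
summation over the columns finish the proof. Taking `I = ∅` gives the norm bound; a singleton `I`
detects the equality case. -/
theorem IsSVD.sum_rpow_add_le (hA : IsSVD A u v a) (hp : 1 < p)
    (hs : Summable fun i => a i ^ p) {x y : κ → H} (hx : IsBessel x) (hy : IsBessel y)
    (J : Finset κ) (I : Finset ι) :
    ∑ j ∈ J, (‖inner ℂ (y j) (A (x j))‖ ^ p +
      ∑ i ∈ I, tangentGap p (a i) ‖inner ℂ (y j) (A (x j))‖ *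
        ((‖inner ℂ (u i) (x j)‖ ^ 2 + ‖inner ℂ (v i) (y j)‖ ^ 2) / 2)) ≤ ∑' i, a i ^ p := by
  set m : κ → ι → ℝ := fun j i => (‖inner ℂ (u i) (x j)‖ ^ 2 + ‖inner ℂ (v i) (y j)‖ ^ 2) / 2
    with hm
  have hm0 : ∀ j i, 0 ≤ m j i := fun j i => by positivity
  have hmJ : ∀ i, ∑ j ∈ J, m j i ≤ 1 := by
    intro i
    simp only [hm]
    rw [← Finset.sum_div, Finset.sum_add_distrib]
    have h1 := hx J (u i)
    have h2 := hy J (v i)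
    simp_rw [norm_inner_symm (x _)] at h1
    simp_rw [norm_inner_symm (y _)] at h2
    have h3 := hA.left.norm_le_one i
    have h4 := hA.right.norm_le_one i
    have h5 : ‖u i‖ ^ 2 ≤ 1 := pow_le_one₀ (norm_nonneg _) h3
    have h6 : ‖v i‖ ^ 2 ≤ 1 := pow_le_one₀ (norm_nonneg _) h4
    linarith
  have hms : ∀ j, Summable (m j) := fun j =>
    ((hA.left.summable (x j)).add (hA.right.summable (y j))).div_const 2
  have hm1 : ∀ j, ∑' i, m j i ≤ 1 := by
    intro j
    simp only [hm]
    rw [tsum_div_const, (hA.left.summable (x j)).tsum_add (hA.right.summable (y j))]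
    have h1 := hA.left.tsum_le (x j)
    have h2 := hA.right.tsum_le (y j)
    have h5 : ‖x j‖ ^ 2 ≤ 1 := pow_le_one₀ (norm_nonneg _) (hx.norm_le_one j)
    have h6 : ‖y j‖ ^ 2 ≤ 1 := pow_le_one₀ (norm_nonneg _) (hy.norm_le_one j)
    linarith
  set M := (∑' i, a i ^ p) ^ (1 / p)
  have haM : ∀ i, a i ≤ M := le_tsum_rpow_rpow hp hA.nonneg hs
  have has : ∀ j, Summable fun i => a i * m j i := fun j =>
    Summable.of_nonneg_of_le (fun i => mul_nonneg (hA.nonneg i) (hm0 j i))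
      (fun i => mul_le_mul_of_nonneg_right (haM i) (hm0 j i)) ((hms j).mul_left M)
  have haps : ∀ j, Summable fun i => a i ^ p * m j i := fun j =>
    Summable.of_nonneg_of_le (fun i => mul_nonneg (Real.rpow_nonneg (hA.nonneg i) p) (hm0 j i))
      (fun i => mul_le_mul_of_nonneg_right
        (Real.rpow_le_rpow (hA.nonneg i) (haM i) (by linarith)) (hm0 j i))
      ((hms j).mul_left (M ^ p))
  have hd : ∀ j, ‖inner ℂ (y j) (A (x j))‖ ≤ ∑' i, a i * m j i := by
    intro j
    have h1 := (hA.hasSum (x j)).mapL (innerSL ℂ (y j))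
    simp only [innerSL_apply_apply, inner_smul_right] at h1
    rw [← h1.tsum_eq]
    refine tsum_of_norm_bounded (has j).hasSum fun i => ?_
    rw [norm_mul, norm_mul, Complex.norm_real, Real.norm_of_nonneg (hA.nonneg i), mul_assoc,
      norm_inner_symm (y j)]
    refine mul_le_mul_of_nonneg_left ?_ (hA.nonneg i)
    simp only [hm]
    nlinarith [sq_nonneg (‖inner ℂ (u i) (x j)‖ - ‖inner ℂ (v i) (y j)‖)]
  calc _ ≤ ∑ j ∈ J, ∑' i, a i ^ p * m j i := Finset.sum_le_sum fun j _ =>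
        rpow_add_sum_tangentGap_le hp hA.nonneg (hm0 j) (norm_nonneg _) (hms j) (hm1 j) (has j)
          (haps j) (hd j) I
    _ = ∑' i, ∑ j ∈ J, a i ^ p * m j i := (Summable.tsum_finsetSum fun j _ => haps j).symm
    _ ≤ ∑' i, a i ^ p := by
      refine Summable.tsum_le_tsum (fun i => ?_) (summable_sum fun j _ => haps j) hs
      rw [← Finset.mul_sum]
      exact mul_le_of_le_one_right (Real.rpow_nonneg (hA.nonneg i) p) (hmJ i)

end SVD

/-! ### Functional calculus on eigenvectors, and eigenbases of compact operators -/

section EigenCFC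
universe u w
variable {H : Type u} [NormedAddCommGroup H] [InnerProductSpace ℂ H] [CompleteSpace H]

/-- The continuous functional calculus acts on eigenvectors through the eigenvalue. -/
theorem cfc_apply_eigenvector {T : H →L[ℂ] H} (hT : IsSelfAdjoint T) {l : ℝ} {u : H}
    (hu : T u = (l : ℂ) • u) {f : ℝ → ℝ} (hf : ContinuousOn f (spectrum ℝ T)) :
    cfc f T u = (f l : ℂ) • u := by
  by_cases hu0 : u = 0
  · simp [hu0]
  have hl : l ∈ spectrum ℝ T := by
    rw [spectrum.mem_iff]
    intro h
    obtain ⟨S, hS⟩ := h.exists_left_inv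
    have := congrArg (fun R : H →L[ℂ] H => R u) hS
    simp only [mul_apply_eq_comp, sub_apply, hu, Algebra.algebraMap_eq_smul_one,
      smul_apply, one_apply_eq_self] at this
    rw [show (l • u : H) = (l : ℂ) • u from (Complex.coe_smul l u).symm, sub_self, map_zero] at this
    exact hu0 this.symm
  rw [cfc_apply f T hT hf]
  -- Stone–Weierstrass: the functions with this property form a closed star subalgebra containing
  -- the identity.
  have key : ∀ g : C(spectrum ℝ T, ℝ), cfcHom hT g u = (g ⟨l, hl⟩ : ℂ) • u := by
    intro g
    induction g using ContinuousMap.induction_on_of_compact with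
    | const r =>
      have : (ContinuousMap.const (spectrum ℝ T) r) = algebraMap ℝ C(spectrum ℝ T, ℝ) r := rfl
      rw [this, AlgHomClass.commutes, Algebra.algebraMap_eq_smul_one]
      simp
    | id =>
      rw [cfcHom_id hT, hu]; rfl
    | star_id =>
      rw [map_star, cfcHom_id hT, hT.star_eq, hu]; rfl
    | add f g hf hg => rw [map_add, add_apply, hf, hg]; simp [add_smul]
    | mul f g hf hg =>
      rw [map_mul, mul_apply_eq_comp, hg, map_smul, hf, smul_smul]; simp [mul_comm]
    | frequently f h =>
      have hc : IsClosed {g : C(spectrum ℝ T, ℝ) | cfcHom hT g u = (g ⟨l, hl⟩ : ℂ) • u} := by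
        refine isClosed_eq ?_ ?_
        · exact ((ContinuousLinearMap.apply ℂ H u).continuous).comp (cfcHom_continuous hT)
        · exact (Complex.continuous_ofReal.comp (continuous_eval_const _)).smul continuous_const
      exact hc.mem_of_frequently_of_tendsto h tendsto_id
  rw [key]; rfl

/-- Here `|A| ^ p = (A⋆ A) ^ (p / 2)`, and `(a ^ 2) ^ (p / 2) = a ^ p`. -/
theorem abs_rpow_apply_eigenvector {A : H →L[ℂ] H} {p a : ℝ} (hp : 0 < p) (ha : 0 ≤ a) {u : H}
    (hu : (star A * A) u = ((a ^ 2 : ℝ) : ℂ) • u) :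
    (CFC.abs A ^ p) u = ((a ^ p : ℝ) : ℂ) • u := by
  have h0 : 0 ≤ star A * A := star_mul_self_nonneg A
  rw [CFC.abs, CFC.sqrt_eq_rpow, CFC.rpow_rpow_of_exponent_nonneg _ _ _ (by norm_num) hp.le,
    CFC.rpow_eq_cfc_real,
    cfc_apply_eigenvector (IsSelfAdjoint.of_nonneg h0) hu
      (Real.continuous_rpow_const (by positivity)).continuousOn,
    ← Real.rpow_natCast a 2, ← Real.rpow_mul ha]
  congr 4
  push_cast; ring

/-- An orthogonal family of complete subspaces with dense sum contains a Hilbert basis. -/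
theorem exists_hilbertBasis_of_orthogonalFamily {κ : Type w} (E : κ → Submodule ℂ H)
    [∀ k, CompleteSpace (E k)] (ho : OrthogonalFamily ℂ (fun k => E k) fun k => (E k).subtypeₗᵢ)
    (hE : (⨆ k, E k)ᗮ = ⊥) :
    ∃ (ι : Type (max u w)) (u : HilbertBasis ι ℂ H) (k : ι → κ), ∀ i, u i ∈ E (k i) := by
  choose w b hb using fun k => exists_hilbertBasis ℂ (E k)
  have hon := ho.orthonormal_sigma_orthonormal (fun k => (b k).orthonormal)
  have hbot : (Submodule.span ℂ (Set.range fun a : Σ k, w k =>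
      (E a.1).subtypeₗᵢ (b a.1 a.2)))ᗮ = ⊥ := by
    rw [← le_bot_iff, ← hE]
    intro x hx
    rw [← Submodule.iInf_orthogonal, Submodule.mem_iInf]
    intro k y hy
    have h2 := ((b k).hasSum_repr ⟨y, hy⟩).mapL ((innerSL ℂ x).comp (E k).subtypeL)
    have h3 : inner ℂ x y = 0 := by
      refine h2.unique ?_
      convert hasSum_zero with i
      rw [Submodule.mem_orthogonal'] at hx
      have h4 : inner ℂ x ((b k i : E k) : H) = 0 := hx _ (Submodule.subset_span ⟨⟨k, i⟩, rfl⟩)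
      rw [map_smul, ContinuousLinearMap.comp_apply, Submodule.subtypeL_apply, innerSL_apply_apply,
        h4, smul_zero]
    rw [← inner_conj_symm, h3, map_zero]
  refine ⟨_, HilbertBasis.mkOfOrthogonalEqBot hon hbot, fun a => a.1, fun a => ?_⟩
  rw [HilbertBasis.coe_mkOfOrthogonalEqBot]
  exact (b a.1 a.2).2

/-- A Hilbert basis of eigenvectors of a compact self-adjoint operator. -/
theorem exists_hilbertBasis_eigenvectors {T : H →L[ℂ] H} (hT : IsSelfAdjoint T)
    (hc : IsCompactOperator T) : ∃ (ι : Type u) (u : HilbertBasis ι ℂ H) (l : ι → ℂ),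
      ∀ i, T (u i) = l i • u i := by
  have hs : (T : H →ₗ[ℂ] H).IsSymmetric := ContinuousLinearMap.isSelfAdjoint_iff_isSymmetric.mp hT
  have hcomp : ∀ μ, CompleteSpace (Module.End.eigenspace (T : H →ₗ[ℂ] H) μ) := fun μ => by
    have : IsClosed ((Module.End.eigenspace (T : H →ₗ[ℂ] H) μ : Submodule ℂ H) : Set H) := by
      have e : ((Module.End.eigenspace (T : H →ₗ[ℂ] H) μ : Submodule ℂ H) : Set H) =
          {x | T x = μ • x} := by
        ext x; simp
      rw [e]
      exact isClosed_eq T.continuous (continuous_const_smul μ)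
    exact this.completeSpace_coe
  obtain ⟨ι, u, l, h⟩ := exists_hilbertBasis_of_orthogonalFamily _ hs.orthogonalFamily_eigenspaces
    (ContinuousLinearMap.orthogonalComplement_iSup_eigenspaces_eq_bot hc hs)
  exact ⟨ι, u, l, fun i => Module.End.mem_eigenspace_iff.mp (h i)⟩

end EigenCFC

/-! ### The variational description of the Schatten norm -/

section SchattenBound

universe u
variable {H : Type u} [NormedAddCommGroup H] [InnerProductSpace ℂ H]

/-- The finite diagonals `(⟪yⱼ, A xⱼ⟫)ⱼ` of `A` have `ℓ^p`-norm at most `C`. -/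
def SchattenBound (p : ℝ) (A : H →L[ℂ] H) (C : ℝ) : Prop :=
  ∀ (n : ℕ) (x y : Fin n → H), IsBessel x → IsBessel y →
    ∑ j, ‖inner ℂ (y j) (A (x j))‖ ^ p ≤ C ^ p

variable {A : H →L[ℂ] H} {p C : ℝ}

theorem SchattenBound.sum_le (h : SchattenBound p A C) {κ : Type*} {x y : κ → H}
    (hx : IsBessel x) (hy : IsBessel y) (J : Finset κ) :
    ∑ j ∈ J, ‖inner ℂ (y j) (A (x j))‖ ^ p ≤ C ^ p := by
  have e := J.equivFin.symm
  have hf : Function.Injective (fun k => (e k : κ)) := Subtype.coe_injective.comp e.injective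
  have := h _ _ _ (hx.comp hf) (hy.comp hf)
  rw [← Finset.sum_coe_sort, ← Equiv.sum_comp e]
  exact this

theorem IsSVD.schattenBound {ι : Type*} {u v : ι → H} {a : ι → ℝ} (hA : IsSVD A u v a)
    (hp : 1 < p) (hs : Summable fun i => a i ^ p) (hC : ∑' i, a i ^ p ≤ C ^ p) :
    SchattenBound p A C := fun n x y hx hy => by
  have := hA.sum_rpow_add_le hp hs hx hy Finset.univ ∅
  simp only [Finset.sum_empty, add_zero] at this
  exact this.trans hC

theorem SchattenBound.norm_inner_le (h : SchattenBound p A C) (hp : 1 < p) (hC : 0 ≤ C)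
    (x y : H) : ‖inner ℂ y (A x)‖ ≤ C * ‖x‖ * ‖y‖ := by
  have h1 : ∀ z : H, ‖z‖ = 1 → IsBessel (fun _ : Fin 1 => z) := fun z hz =>
    Orthonormal.isBessel ⟨fun _ => hz, fun i j hij => absurd (Subsingleton.elim i j) hij⟩
  have h2 : ∀ x y : H, ‖x‖ = 1 → ‖y‖ = 1 → ‖inner ℂ y (A x)‖ ≤ C := fun x y hx hy => by
    have := h 1 _ _ (h1 x hx) (h1 y hy)
    simp only [Finset.univ_unique, Finset.sum_const, Finset.card_singleton, one_smul] at this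
    exact (Real.rpow_le_rpow_iff (norm_nonneg _) hC (by linarith)).mp this
  by_cases hx : x = 0
  · simp [hx]
  by_cases hy : y = 0
  · simp [hy]
  have hx' := norm_ne_zero_iff.mpr hx
  have hy' := norm_ne_zero_iff.mpr hy
  have h3 := h2 (((‖x‖⁻¹ : ℝ) : ℂ) • x) (((‖y‖⁻¹ : ℝ) : ℂ) • y)
    (by rw [norm_smul, Complex.norm_real, norm_inv, norm_norm, inv_mul_cancel₀ hx'])
    (by rw [norm_smul, Complex.norm_real, norm_inv, norm_norm, inv_mul_cancel₀ hy'])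
  rw [map_smul, inner_smul_left, inner_smul_right, norm_mul, norm_mul, RCLike.norm_conj,
    Complex.norm_real, Complex.norm_real, norm_inv, norm_inv, norm_norm, norm_norm] at h3
  calc ‖inner ℂ y (A x)‖ = (‖y‖⁻¹ * (‖x‖⁻¹ * ‖inner ℂ y (A x)‖)) * ‖x‖ * ‖y‖ := by field_simp
    _ ≤ _ := by gcongr

theorem SchattenBound.norm_le (h : SchattenBound p A C) (hp : 1 < p) (hC : 0 ≤ C) : ‖A‖ ≤ C := by
  refine A.opNorm_le_bound hC fun x => ?_
  have h1 := h.norm_inner_le hp hC x (A x)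
  rw [inner_self_eq_norm_sq_to_K] at h1
  simp only [norm_pow, Complex.coe_algebraMap, Complex.norm_real, norm_norm] at h1
  by_cases h0 : A x = 0
  · rw [h0, norm_zero]; positivity
  · have : 0 < ‖A x‖ := norm_pos_iff.mpr h0
    rw [sq] at h1
    exact le_of_mul_le_mul_right h1 this

theorem SchattenBound.mono {C' : ℝ} (h : SchattenBound p A C) (hp : 1 < p) (hC : 0 ≤ C)
    (hCC : C ≤ C') : SchattenBound p A C' := fun n x y hx hy =>
  (h n x y hx hy).trans (Real.rpow_le_rpow hC hCC (by linarith))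

/-- Either `A` is close to a compact operator, or a pair of orthonormal systems on which `A` is
large can be enlarged. -/
theorem exists_orthonormal_or_exists_compact (A : H →L[ℂ] H) {ε : ℝ} (hε : 0 < ε) (n : ℕ) :
    (∃ F : H →L[ℂ] H, IsCompactOperator F ∧ ‖A - F‖ ≤ ε) ∨
    ∃ x y : Fin n → H, Orthonormal ℂ x ∧ Orthonormal ℂ y ∧
      ∀ j, ε ≤ ‖inner ℂ (y j) (A (x j))‖ := by
  induction n with
  | zero =>
    exact Or.inr ⟨Fin.elim0, Fin.elim0, ⟨fun i => i.elim0, fun i => i.elim0⟩,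
      ⟨fun i => i.elim0, fun i => i.elim0⟩, fun i => i.elim0⟩
  | succ n ih =>
    rcases ih with h | ⟨x, y, hx, hy, hxy⟩
    · exact Or.inl h
    set E := Submodule.span ℂ (Set.range x)
    set K := Submodule.span ℂ (Set.range y)
    have hcomp : ∀ L : Submodule ℂ H, FiniteDimensional ℂ L →
        ∀ [L.HasOrthogonalProjection], IsCompactOperator L.starProjection := by
      intro L hL _
      have : IsCompactOperator L.orthogonalProjectionOnto :=
        isCompactOperator_of_locallyCompactSpace_dom _
      exact this.clm_comp L.subtypeL
    have hE : FiniteDimensional ℂ E := FiniteDimensional.span_of_finite ℂ (Set.finite_range x)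
    have hK : FiniteDimensional ℂ K := FiniteDimensional.span_of_finite ℂ (Set.finite_range y)
    -- With `P`, `Q` the projections onto `E`, `K`, this choice gives `A - F = (1 - Q) A (1 - P)`. A
    -- vector on which it is large yields a new pair orthogonal to the old systems.
    set F : H →L[ℂ] H := A ∘L E.starProjection + K.starProjection ∘L (A - A ∘L E.starProjection)
    have hF : IsCompactOperator F :=
      ((hcomp E hE).clm_comp A).add ((hcomp K hK).comp_clm _)
    by_cases hn : ‖A - F‖ ≤ ε
    · exact Or.inl ⟨F, hF, hn⟩
    obtain ⟨z, hz⟩ : ∃ z, ε * ‖z‖ < ‖(A - F) z‖ := by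
      by_contra! hcon
      exact hn (ContinuousLinearMap.opNorm_le_bound _ hε.le hcon)
    set x' := z - E.starProjection z with hx'
    set y' := A x' - K.starProjection (A x') with hy'
    have hyz : (A - F) z = y' := by
      simp only [F, hx', hy', sub_apply, add_apply, ContinuousLinearMap.comp_apply, map_sub]
      abel
    rw [hyz] at hz
    have hx'E : x' ∈ Eᗮ := E.sub_starProjection_mem_orthogonal z
    have hy'K : y' ∈ Kᗮ := K.sub_starProjection_mem_orthogonal _
    have hx'z : ‖x'‖ ≤ ‖z‖ := by
      rw [hx', ← Submodule.starProjection_orthogonal_val]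
      exact Submodule.norm_starProjection_apply_le _ z
    have hy0 : 0 < ‖y'‖ := lt_of_le_of_lt (by positivity) hz
    have hx0 : 0 < ‖x'‖ := by
      rw [norm_pos_iff]; intro h
      rw [hy', h, map_zero, map_zero, sub_zero, norm_zero] at hy0
      exact lt_irrefl _ hy0
    have hin : inner ℂ y' (A x') = ((‖y'‖ ^ 2 : ℝ) : ℂ) := by
      have h1 : A x' = y' + K.starProjection (A x') := by rw [hy']; abel
      have h2 : inner ℂ y' (K.starProjection (A x')) = 0 :=
        (Submodule.mem_orthogonal' K y').mp hy'K _ (K.starProjection_apply_mem _)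
      have h3 := congrArg (inner ℂ y') h1
      rw [h3, inner_add_right, h2, add_zero, inner_self_eq_norm_sq_to_K]
      simp
    refine Or.inr ⟨Matrix.vecCons (((‖x'‖⁻¹ : ℝ) : ℂ) • x') x,
      Matrix.vecCons (((‖y'‖⁻¹ : ℝ) : ℂ) • y') y, ?_, ?_, ?_⟩
    · refine orthonormal_vecCons_iff.mpr ⟨?_, fun i => ?_, hx⟩
      · rw [norm_smul, Complex.norm_real, norm_inv, norm_norm, inv_mul_cancel₀ hx0.ne']
      · rw [inner_smul_left, (Submodule.mem_orthogonal' E x').mp hx'E _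
          (Submodule.subset_span ⟨i, rfl⟩), mul_zero]
    · refine orthonormal_vecCons_iff.mpr ⟨?_, fun i => ?_, hy⟩
      · rw [norm_smul, Complex.norm_real, norm_inv, norm_norm, inv_mul_cancel₀ hy0.ne']
      · rw [inner_smul_left, (Submodule.mem_orthogonal' K y').mp hy'K _
          (Submodule.subset_span ⟨i, rfl⟩), mul_zero]
    · intro j
      refine Fin.cases ?_ (fun j => ?_) j
      · simp only [Matrix.cons_val_zero]
        rw [map_smul, inner_smul_left, inner_smul_right, norm_mul, norm_mul, RCLike.norm_conj,
          Complex.norm_real, Complex.norm_real, norm_inv, norm_inv, norm_norm, norm_norm, hin,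
          Complex.norm_real, norm_pow, norm_norm]
        have : ε * ‖x'‖ ≤ ‖y'‖ := (mul_le_mul_of_nonneg_left hx'z hε.le).trans hz.le
        calc ε = ε * ‖x'‖ * ‖x'‖⁻¹ := by field_simp
          _ ≤ ‖y'‖ * ‖x'‖⁻¹ := by gcongr
          _ = _ := by field_simp
      · simpa using hxy j

variable [CompleteSpace H]

/-- Singular value decomposition of a compact operator. -/
theorem exists_isSVD {A : H →L[ℂ] H} (hA : IsCompactOperator A) :
    ∃ (ι : Type u) (u : HilbertBasis ι ℂ H) (v : ι → H) (a : ι → ℝ), IsSVD A u v a ∧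
      (∀ i, A (u i) = (a i : ℂ) • v i) ∧ (∀ i, inner ℂ (v i) (A (u i)) = (a i : ℂ)) ∧
      ∀ p : ℝ, 0 < p → ∀ i, (CFC.abs A ^ p) (u i) = ((a i ^ p : ℝ) : ℂ) • u i := by
  obtain ⟨ι, u, l, hl⟩ := exists_hilbertBasis_eigenvectors (IsSelfAdjoint.star_mul_self A)
    (IsCompactOperator.clm_comp hA (star A))
  have hin : ∀ i j, inner ℂ (A (u i)) (A (u j)) = l j * inner ℂ (u i) (u j) := fun i j => by
    rw [← inner_smul_right, ← hl, mul_apply_eq_comp, ContinuousLinearMap.star_eq_adjoint,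
      ContinuousLinearMap.adjoint_inner_right]
  have hnorm : ∀ i, ‖u i‖ = 1 := u.orthonormal.1
  have hla : ∀ i, l i = ((‖A (u i)‖ ^ 2 : ℝ) : ℂ) := fun i => by
    have h := hin i i
    rw [inner_self_eq_norm_sq_to_K, inner_self_eq_norm_sq_to_K, hnorm] at h
    simpa using h.symm
  set a : ι → ℝ := fun i => ‖A (u i)‖ with ha
  -- Since `0⁻¹ = 0`, this vanishes when `a i = 0`. So `v` is orthonormal only up to zero vectors,
  -- which is why Bessel families are used.
  set v : ι → H := fun i => ((a i : ℂ)⁻¹) • A (u i) with hv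
  have hav : ∀ i, A (u i) = (a i : ℂ) • v i := fun i => by
    by_cases h : a i = 0
    · simp only [h, Complex.ofReal_zero, zero_smul]; exact norm_eq_zero.mp h
    · simp only [hv]
      rw [smul_smul, mul_inv_cancel₀ (by exact_mod_cast h), one_smul]
  have hvb : IsBessel v := by
    refine isBessel_of_orthogonal (fun i j hij => ?_) fun i hi => ?_
    · simp only [hv]
      rw [inner_smul_left, inner_smul_right, hin, u.orthonormal.2 hij, mul_zero, mul_zero, mul_zero]
    · have h : a i ≠ 0 := fun h => hi (by simp [hv, h])
      simp only [hv]
      rw [norm_smul, norm_inv, Complex.norm_real, norm_norm]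
      exact inv_mul_cancel₀ h
  refine ⟨ι, u, v, a, ⟨u.orthonormal.isBessel, hvb, fun i => norm_nonneg _, fun x => ?_⟩, hav,
    fun i => ?_, fun p hp i => ?_⟩
  · have h := (u.hasSum_repr x).mapL A
    have e : (fun i => A (u.repr x i • u i)) = fun i => ((a i : ℂ) * inner ℂ (u i) x) • v i := by
      ext i
      rw [map_smul, hav, u.repr_apply_apply, smul_smul, mul_comm]
    rwa [e] at h
  · simp only [hv]
    rw [inner_smul_left, inner_self_eq_norm_sq_to_K]
    by_cases h : a i = 0
    · simp [h]
    · have h' : (a i : ℂ) ≠ 0 := by exact_mod_cast h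
      simp only [map_inv₀, Complex.conj_ofReal]
      change (a i : ℂ)⁻¹ * (a i : ℂ) ^ 2 = a i
      field_simp
  · refine abs_rpow_apply_eigenvector hp (norm_nonneg _) ?_
    rw [hl, hla]

/-- Orthonormal systems of length `n` with diagonal entries at least `ε` force `n * ε ^ p ≤ C ^ p`.
For large `n` the other alternative must hold, so `A` is an operator-norm limit of compact
operators. -/
theorem SchattenBound.isCompactOperator (h : SchattenBound p A C) (hp : 1 < p) :
    IsCompactOperator A := by
  have key : ∀ ε : ℝ, 0 < ε → ∃ F : H →L[ℂ] H, IsCompactOperator F ∧ ‖A - F‖ ≤ ε := by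
    intro ε hε
    have hεp : 0 < ε ^ p := by positivity
    obtain ⟨n, hn⟩ := exists_nat_gt (C ^ p / ε ^ p)
    rcases exists_orthonormal_or_exists_compact A hε n with hF | ⟨x, y, hx, hy, hxy⟩
    · exact hF
    · exfalso
      have h1 := h n x y hx.isBessel hy.isBessel
      have h2 : ∑ _j : Fin n, ε ^ p ≤ ∑ j, ‖inner ℂ (y j) (A (x j))‖ ^ p :=
        Finset.sum_le_sum fun j _ => Real.rpow_le_rpow hε.le (hxy j) (by linarith)
      rw [Finset.sum_const, Finset.card_univ, Fintype.card_fin, nsmul_eq_mul] at h2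
      rw [div_lt_iff₀ hεp] at hn
      linarith
  choose F hF hFA using fun n : ℕ => key (1 / (n + 1)) (by positivity)
  refine isCompactOperator_of_tendsto (l := atTop) (F := F) ?_ (Eventually.of_forall hF)
  rw [tendsto_iff_norm_sub_tendsto_zero]
  refine squeeze_zero (fun _ => norm_nonneg _) (fun n => ?_) tendsto_one_div_add_atTop_nhds_zero_nat
  rw [norm_sub_rev]; exact hFA n

theorem traceAbsPow_eq_tsum {ι : Type*} (u : HilbertBasis ι ℂ H) {a : ι → ℝ}
    (h : ∀ i, (CFC.abs A ^ p) (u i) = ((a i ^ p : ℝ) : ℂ) • u i) :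
    traceAbsPow p A = ∑' i, ENNReal.ofReal (a i ^ p) := by
  rw [traceAbsPow, opTrace_eq u CFC.rpow_nonneg]
  refine tsum_congr fun i => ?_
  rw [ContinuousLinearMap.reApplyInnerSelf_apply, h, inner_smul_left, inner_self_eq_norm_sq_to_K,
    u.orthonormal.1]
  simp

/-- Singular value decomposition of an operator in a Schatten class. -/
theorem exists_isSVD_of_mem (hp : 1 < p) (hA : A ∈ schattenClass H p) :
    ∃ (ι : Type u) (u : HilbertBasis ι ℂ H) (v : ι → H) (a : ι → ℝ), IsSVD A u v a ∧
      (∀ i, A (u i) = (a i : ℂ) • v i) ∧ (∀ i, inner ℂ (v i) (A (u i)) = (a i : ℂ)) ∧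
      (0 ≤ A → ∀ i, A (u i) = (a i : ℂ) • u i) ∧
      HasSum (fun i => a i ^ p) (schattenNorm p A ^ p) := by
  obtain ⟨ι, u, v, a, h, h1, h2, h3⟩ := exists_isSVD hA.1
  refine ⟨ι, u, v, a, h, h1, h2, fun h0 i => ?_, ?_⟩
  -- For `A ≥ 0` the exponent `1` gives `|A| = A`, so the right singular vectors are eigenvectors.
  · have := h3 1 one_pos i
    rwa [CFC.abs_of_nonneg A h0, CFC.rpow_one A h0, Real.rpow_one] at this
  · have h4 := traceAbsPow_eq_tsum u (h3 p (by linarith))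
    have h5 : ∀ i, 0 ≤ a i ^ p := fun i => Real.rpow_nonneg (h.nonneg i) p
    have h6 : schattenNorm p A ^ p = (traceAbsPow p A).toReal := by
      rw [schattenNorm, ← Real.rpow_mul ENNReal.toReal_nonneg, one_div_mul_cancel (by linarith),
        Real.rpow_one]
    have h7 := hA.2
    rw [h4] at h7
    have h8 := ENNReal.hasSum_toReal h7
    rw [h6, h4]
    rw [ENNReal.tsum_toReal_eq fun i => ENNReal.ofReal_ne_top]
    convert h8 using 2 with i
    rw [ENNReal.toReal_ofReal (h5 i)]

theorem schattenNorm_nonneg (p : ℝ) (A : H →L[ℂ] H) : 0 ≤ schattenNorm p A :=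
  Real.rpow_nonneg ENNReal.toReal_nonneg _

theorem schattenBound_schattenNorm (hp : 1 < p) (hA : A ∈ schattenClass H p) :
    SchattenBound p A (schattenNorm p A) := by
  obtain ⟨ι, u, v, a, h, -, -, -, h4⟩ := exists_isSVD_of_mem hp hA
  exact h.schattenBound hp h4.summable h4.tsum_eq.le

/-- Along the singular vectors the diagonal of `A` consists of the singular values, so the bound
controls the trace. -/
theorem SchattenBound.mem_schattenClass (h : SchattenBound p A C) (hp : 1 < p) :
    A ∈ schattenClass H p := by
  have hc := h.isCompactOperator hp
  refine ⟨hc, ?_⟩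
  obtain ⟨ι, u, v, a, h0, h1, h2, h3⟩ := exists_isSVD hc
  rw [traceAbsPow_eq_tsum u (h3 p (by linarith))]
  have hs : Summable fun i => a i ^ p := by
    refine summable_of_sum_le (c := C ^ p) (fun i => Real.rpow_nonneg (h0.nonneg i) p) fun s => ?_
    refine le_trans (le_of_eq ?_) (h.sum_le h0.left h0.right s)
    refine Finset.sum_congr rfl fun i _ => ?_
    rw [h2, Complex.norm_real, Real.norm_of_nonneg (h0.nonneg i)]
  rw [← ENNReal.ofReal_tsum_of_nonneg (fun i => Real.rpow_nonneg (h0.nonneg i) p) hs]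
  exact ENNReal.ofReal_ne_top

theorem SchattenBound.schattenNorm_le (h : SchattenBound p A C) (hp : 1 < p) (hC : 0 ≤ C) :
    schattenNorm p A ≤ C := by
  obtain ⟨ι, u, v, a, h0, h1, h2, -, h4⟩ := exists_isSVD_of_mem hp (h.mem_schattenClass hp)
  rw [← Real.rpow_le_rpow_iff (schattenNorm_nonneg p A) hC (by linarith : 0 < p)]
  refine hasSum_le_of_sum_le h4 fun s => ?_
  refine le_trans (le_of_eq ?_) (h.sum_le h0.left h0.right s)
  refine Finset.sum_congr rfl fun i _ => ?_
  rw [h2, Complex.norm_real, Real.norm_of_nonneg (h0.nonneg i)]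

end SchattenBound

/-! ### Norm, completeness, strict convexity and monotonicity -/

section SchattenSpace

universe u
variable {H : Type u} [NormedAddCommGroup H] [InnerProductSpace ℂ H]
  {A B : H →L[ℂ] H} {p C D : ℝ}

theorem SchattenBound.add (hp : 1 < p) (hC : 0 ≤ C) (hD : 0 ≤ D) (hA : SchattenBound p A C)
    (hB : SchattenBound p B D) : SchattenBound p (A + B) (C + D) := fun n x y hx hy => by
  have hp0 : 0 < p := by linarith
  have h1 : ∀ (T : H →L[ℂ] H) (E : ℝ), 0 ≤ E → SchattenBound p T E →
      (∑ j, ‖inner ℂ (y j) (T (x j))‖ ^ p) ^ (1 / p) ≤ E := fun T E hE hT => by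
    have := Real.rpow_le_rpow (z := 1 / p) (by positivity) (hT n x y hx hy) (by positivity)
    rwa [← Real.rpow_mul hE, mul_one_div_cancel hp0.ne', Real.rpow_one] at this
  have h2 := Real.Lp_add_le_of_nonneg Finset.univ hp.le
    (f := fun j => ‖inner ℂ (y j) (A (x j))‖) (g := fun j => ‖inner ℂ (y j) (B (x j))‖)
    (fun _ _ => norm_nonneg _) (fun _ _ => norm_nonneg _)
  have h3 := h2.trans (add_le_add (h1 A C hC hA) (h1 B D hD hB))
  have h4 := Real.rpow_le_rpow (z := p) (by positivity) h3 hp0.le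
  rw [← Real.rpow_mul (by positivity), one_div_mul_cancel hp0.ne', Real.rpow_one] at h4
  refine le_trans (Finset.sum_le_sum fun j _ => ?_) h4
  refine Real.rpow_le_rpow (norm_nonneg _) ?_ hp0.le
  rw [add_apply, inner_add_right]
  exact norm_add_le _ _

theorem SchattenBound.smul (hC : 0 ≤ C) (hA : SchattenBound p A C) (c : ℂ) :
    SchattenBound p (c • A) (‖c‖ * C) := fun n x y hx hy => by
  have h := mul_le_mul_of_nonneg_left (hA n x y hx hy)
    (Real.rpow_nonneg (norm_nonneg c) p)
  rw [← Real.mul_rpow (norm_nonneg c) hC, Finset.mul_sum] at h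
  refine le_trans (le_of_eq (Finset.sum_congr rfl fun j _ => ?_)) h
  rw [smul_apply, inner_smul_right, norm_mul, Real.mul_rpow (norm_nonneg _) (norm_nonneg _)]

theorem SchattenBound.zero (hp : 1 < p) : SchattenBound p (0 : H →L[ℂ] H) 0 :=
  fun n x y _ _ => by
    have : p ≠ 0 := by linarith
    simp [Real.zero_rpow this]

/-- Each inequality in the bound involves only finitely many matrix entries, which depend
continuously on the operator. -/
theorem SchattenBound.of_tendsto {ι : Type*} {l : Filter ι} [l.NeBot] (hp : 1 < p)
    {As : ι → H →L[ℂ] H} (hAs : Tendsto As l (𝓝 A)) (h : ∀ᶠ i in l, SchattenBound p (As i) C) :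
    SchattenBound p A C := fun n x y hx hy => by
  have h1 : Tendsto (fun i => ∑ j, ‖inner ℂ (y j) (As i (x j))‖ ^ p) l
      (𝓝 (∑ j, ‖inner ℂ (y j) (A (x j))‖ ^ p)) := by
    refine tendsto_finsetSum _ fun j _ => ?_
    refine Tendsto.rpow_const ?_ (Or.inr (by linarith))
    have h2 : Tendsto (fun i => As i (x j)) l (𝓝 (A (x j))) :=
      ((ContinuousLinearMap.apply ℂ H (x j)).continuous.tendsto A).comp hAs
    exact (tendsto_const_nhds.inner h2).norm
  exact le_of_tendsto h1 (h.mono fun i hi => hi n x y hx hy)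

/-- If a diagonal of `A` has the same `ℓ^p`-norm as the singular values of `A`, then `A` is
diagonal. -/
theorem IsSVD.apply_eq_inner_smul {ι κ : Type*} {u v : ι → H} {a : ι → ℝ} (hA : IsSVD A u v a)
    (hp : 1 < p) (hs : Summable fun i => a i ^ p) {x y : κ → H} (hx : IsBessel x)
    (hy : IsBessel y) {S : ℝ} (hS : HasSum (fun j => ‖inner ℂ (y j) (A (x j))‖ ^ p) S)
    (haS : ∑' i, a i ^ p ≤ S) (j : κ) : A (x j) = inner ℂ (y j) (A (x j)) • y j := by
  classical
  set d := ‖inner ℂ (y j) (A (x j))‖ with hd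
  -- Otherwise the defect `c` in row `j` is positive and `S + c ≤ ∑ aᵢ ^ p ≤ S`.
  have hai : ∀ i, inner ℂ (u i) (x j) ≠ 0 → a i = d := by
    intro i hi
    by_contra hne
    have hgap := tangentGap_pos hp (hA.nonneg i) (norm_nonneg _) hne
    set c := tangentGap p (a i) d * ((‖inner ℂ (u i) (x j)‖ ^ 2 + ‖inner ℂ (v i) (y j)‖ ^ 2) / 2)
      with hc
    have hc0 : 0 < c := by
      have := norm_pos_iff.mpr hi
      positivity
    have h1 : S + c ≤ ∑' i, a i ^ p := by
      refine le_of_tendsto (hS.add_const c) ?_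
      filter_upwards [eventually_ge_atTop {j}] with J hJ
      refine le_trans ?_ (hA.sum_rpow_add_le hp hs hx hy J {i})
      rw [Finset.sum_add_distrib]
      refine add_le_add le_rfl ?_
      simp only [Finset.sum_singleton]
      refine Finset.single_le_sum (f := fun j => tangentGap p (a i) ‖inner ℂ (y j) (A (x j))‖ *
        ((‖inner ℂ (u i) (x j)‖ ^ 2 + ‖inner ℂ (v i) (y j)‖ ^ 2) / 2)) (fun k _ => ?_)
        (hJ (Finset.mem_singleton_self j))
      exact mul_nonneg (tangentGap_nonneg hp (hA.nonneg i) (norm_nonneg _)) (by positivity)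
    linarith
  -- Only singular values equal to `d` contribute to `A (x j)`. Testing against the unit vector `z`
  -- in its direction gives the bound by AM-GM and Bessel.
  have hle : ‖A (x j)‖ ≤ d := by
    by_cases hw : A (x j) = 0
    · rw [hw, norm_zero]; exact norm_nonneg _
    have hw0 : (‖A (x j)‖ : ℂ) ≠ 0 := by exact_mod_cast norm_ne_zero_iff.mpr hw
    set z := ((‖A (x j)‖ : ℂ)⁻¹) • A (x j) with hz
    have hz1 : ‖z‖ = 1 := by
      rw [hz, norm_smul, norm_inv, Complex.norm_real, norm_norm]
      exact inv_mul_cancel₀ (norm_ne_zero_iff.mpr hw)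
    have hzA : ‖inner ℂ z (A (x j))‖ = ‖A (x j)‖ := by
      rw [hz, inner_smul_left, inner_self_eq_norm_sq_to_K, map_inv₀, Complex.conj_ofReal, sq]
      simp only [Complex.coe_algebraMap]
      rw [inv_mul_cancel_left₀ hw0, Complex.norm_real, norm_norm]
    have h1 := (hA.hasSum (x j)).mapL (innerSL ℂ z)
    simp only [innerSL_apply_apply, inner_smul_right] at h1
    have hsum : Summable fun i => d * ((‖inner ℂ (u i) (x j)‖ ^ 2 + ‖inner ℂ (v i) z‖ ^ 2) / 2) :=
      (((hA.left.summable (x j)).add (hA.right.summable z)).div_const 2).mul_left d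
    have h2 : ‖inner ℂ z (A (x j))‖ ≤
        ∑' i, d * ((‖inner ℂ (u i) (x j)‖ ^ 2 + ‖inner ℂ (v i) z‖ ^ 2) / 2) := by
      rw [← h1.tsum_eq]
      refine tsum_of_norm_bounded hsum.hasSum fun i => ?_
      by_cases hi : inner ℂ (u i) (x j) = 0
      · rw [hi, mul_zero, zero_mul, norm_zero]; positivity
      · rw [norm_mul, norm_mul, Complex.norm_real, hai i hi, Real.norm_of_nonneg (norm_nonneg _),
          mul_assoc, norm_inner_symm z]
        refine mul_le_mul_of_nonneg_left ?_ (norm_nonneg _)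
        nlinarith [sq_nonneg (‖inner ℂ (u i) (x j)‖ - ‖inner ℂ (v i) z‖)]
    rw [hzA, tsum_mul_left, tsum_div_const,
      (hA.left.summable (x j)).tsum_add (hA.right.summable z)] at h2
    refine h2.trans (mul_le_of_le_one_right (norm_nonneg _) ?_)
    have h3 := hA.left.tsum_le (x j)
    have h4 := hA.right.tsum_le z
    have h5 : ‖x j‖ ^ 2 ≤ 1 := pow_le_one₀ (norm_nonneg _) (hx.norm_le_one j)
    rw [hz1] at h4
    linarith
  rw [← sub_eq_zero, ← norm_le_zero_iff]
  refine le_of_sq_le_sq (b := (0 : ℝ)) ?_ le_rfl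
  have h6 : ‖A (x j) - inner ℂ (y j) (A (x j)) • y j‖ ^ 2 =
      ‖A (x j)‖ ^ 2 - 2 * d ^ 2 + d ^ 2 * ‖y j‖ ^ 2 := by
    rw [norm_sub_sq (𝕜 := ℂ), inner_smul_right, ← inner_conj_symm (A (x j)), Complex.mul_conj,
      norm_smul, mul_pow, Complex.normSq_eq_norm_sq]
    simp only [hd, RCLike.re_to_complex, Complex.ofReal_re]
  have h7 : ‖y j‖ ^ 2 ≤ 1 := pow_le_one₀ (norm_nonneg _) (hy.norm_le_one j)
  have h8 : ‖A (x j)‖ ^ 2 ≤ d ^ 2 := pow_le_pow_left₀ (norm_nonneg _) hle 2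
  have h9 := mul_le_mul_of_nonneg_left h7 (sq_nonneg d)
  rw [h6]
  linarith

theorem half_add_rpow_lt {p s t : ℝ} (hp : 1 < p) (hs : 0 ≤ s) (ht : 0 ≤ t) (hst : s ≠ t) :
    ((s + t) / 2) ^ p < (s ^ p + t ^ p) / 2 := by
  have h := (strictConvexOn_rpow hp).2 (Set.mem_Ici.mpr hs) (Set.mem_Ici.mpr ht) hst
    (by norm_num : (0 : ℝ) < 1 / 2) (by norm_num : (0 : ℝ) < 1 / 2) (by norm_num)
  simp only [smul_eq_mul] at h
  rwa [← mul_add, ← mul_add, one_div_mul_eq_div, one_div_mul_eq_div] at h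

theorem half_add_rpow_le {p s t : ℝ} (hp : 1 < p) (hs : 0 ≤ s) (ht : 0 ≤ t) :
    ((s + t) / 2) ^ p ≤ (s ^ p + t ^ p) / 2 := by
  by_cases hst : s = t
  · subst hst; simp
  · exact (half_add_rpow_lt hp hs ht hst).le

/-- Strict convexity of `ℓ^p`. -/
theorem eq_of_hasSum_norm_add_rpow {ι : Type*} {f g : ι → ℂ} (hp : 1 < p)
    (hf : ∀ s : Finset ι, ∑ i ∈ s, ‖f i‖ ^ p ≤ 1) (hg : ∀ s : Finset ι, ∑ i ∈ s, ‖g i‖ ^ p ≤ 1)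
    (hfg : HasSum (fun i => ‖f i + g i‖ ^ p) (2 ^ p)) : f = g := by
  have hsf : Summable fun i => ‖f i‖ ^ p := summable_of_sum_le (fun i => by positivity) hf
  have hsg : Summable fun i => ‖g i‖ ^ p := summable_of_sum_le (fun i => by positivity) hg
  have hf1 := hsf.tsum_le_of_sum_le hf
  have hg1 := hsg.tsum_le_of_sum_le hg
  have h2p : (0 : ℝ) < 2 ^ p := by positivity
  have hle : ∀ i, ‖f i + g i‖ ≤ ‖f i‖ + ‖g i‖ := fun i => norm_add_le _ _
  have e : ∀ i, (‖f i‖ + ‖g i‖) ^ p = 2 ^ p * ((‖f i‖ + ‖g i‖) / 2) ^ p := fun i => by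
    rw [← Real.mul_rpow (by norm_num) (by positivity)]; congr 1; ring
  have h1 : ∀ i, ‖f i + g i‖ ^ p ≤ (‖f i‖ + ‖g i‖) ^ p := fun i =>
    Real.rpow_le_rpow (norm_nonneg _) (hle i) (by linarith)
  have h2 : ∀ i, (‖f i‖ + ‖g i‖) ^ p ≤ 2 ^ p * ((‖f i‖ ^ p + ‖g i‖ ^ p) / 2) := fun i => by
    rw [e]
    exact mul_le_mul_of_nonneg_left (half_add_rpow_le hp (norm_nonneg _) (norm_nonneg _)) h2p.le
  -- The termwise defects of the convexity inequality are nonnegative and their sum is at most zero,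
  -- so each one vanishes.
  have h3 := (((hsf.hasSum.add hsg.hasSum).div_const 2).mul_left (2 ^ p)).sub hfg
  have h4 : 2 ^ p * ((∑' i, ‖f i‖ ^ p + ∑' i, ‖g i‖ ^ p) / 2) - 2 ^ p ≤ 0 := by nlinarith
  have h5 : ∀ i, 2 ^ p * ((‖f i‖ ^ p + ‖g i‖ ^ p) / 2) - ‖f i + g i‖ ^ p ≤ 0 := fun i =>
    (le_hasSum h3 i fun j _ => sub_nonneg.mpr ((h1 j).trans (h2 j))).trans h4
  ext i
  have h6 : ‖f i‖ = ‖g i‖ := by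
    by_contra hne
    have h7 := mul_lt_mul_of_pos_left
      (half_add_rpow_lt hp (norm_nonneg (f i)) (norm_nonneg (g i)) hne) h2p
    rw [← e] at h7
    linarith [h1 i, h5 i]
  refine eq_of_norm_eq_of_norm_add_eq h6 (le_antisymm (hle i) ?_)
  rw [← Real.rpow_le_rpow_iff (by positivity) (norm_nonneg _) (by linarith : 0 < p)]
  linarith [h2 i, h5 i]

variable [CompleteSpace H]

theorem norm_le_schattenNorm (hp : 1 < p) (hA : A ∈ schattenClass H p) : ‖A‖ ≤ schattenNorm p A :=
  (schattenBound_schattenNorm hp hA).norm_le hp (schattenNorm_nonneg p A)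

theorem isNormedSubspace_schattenClass (hp : 1 < p) :
    IsNormedSubspace ℂ (schattenClass H p) (schattenNorm p) where
  zero_mem := (SchattenBound.zero hp).mem_schattenClass hp
  add_mem hu hv := ((schattenBound_schattenNorm hp hu).add hp (schattenNorm_nonneg _ _)
    (schattenNorm_nonneg _ _) (schattenBound_schattenNorm hp hv)).mem_schattenClass hp
  smul_mem c _ hu := ((schattenBound_schattenNorm hp hu).smul
    (schattenNorm_nonneg _ _) c).mem_schattenClass hp
  nonneg u _ := schattenNorm_nonneg p u
  eq_zero_iff u hu := by
    constructor
    · intro h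
      have := norm_le_schattenNorm hp hu
      rw [h] at this
      exact norm_le_zero_iff.mp this
    · rintro rfl
      exact le_antisymm ((SchattenBound.zero hp).schattenNorm_le hp le_rfl)
        (schattenNorm_nonneg _ _)
  norm_smul c u hu := by
    have key : ∀ (c : ℂ) (u : H →L[ℂ] H), u ∈ schattenClass H p →
        schattenNorm p (c • u) ≤ ‖c‖ * schattenNorm p u := fun c u hu =>
      ((schattenBound_schattenNorm hp hu).smul (schattenNorm_nonneg _ _) c).schattenNorm_le hp
        (mul_nonneg (norm_nonneg _) (schattenNorm_nonneg _ _))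
    refine le_antisymm (key c u hu) ?_
    by_cases hc : c = 0
    · rw [hc, norm_zero, zero_mul]; exact schattenNorm_nonneg _ _
    have hcu : c • u ∈ schattenClass H p := ((schattenBound_schattenNorm hp hu).smul
      (schattenNorm_nonneg _ _) c).mem_schattenClass hp
    have h := key c⁻¹ (c • u) hcu
    rw [inv_smul_smul₀ hc, norm_inv] at h
    have hc' : 0 < ‖c‖ := norm_pos_iff.mpr hc
    calc ‖c‖ * schattenNorm p u ≤ ‖c‖ * (‖c‖⁻¹ * schattenNorm p (c • u)) :=
          mul_le_mul_of_nonneg_left h hc'.le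
      _ = _ := by rw [mul_inv_cancel_left₀ hc'.ne']
  norm_add_le u hu v hv := ((schattenBound_schattenNorm hp hu).add hp (schattenNorm_nonneg _ _)
    (schattenNorm_nonneg _ _) (schattenBound_schattenNorm hp hv)).schattenNorm_le hp
      (add_nonneg (schattenNorm_nonneg _ _) (schattenNorm_nonneg _ _))

/-- A Cauchy sequence converges in operator norm, and the Schatten bounds of the differences `s m -
s n` pass to the limit in `m`. -/
theorem completeSpace_schattenClass (hp : 1 < p)
    (h : IsNormedSubspace ℂ (schattenClass H p) (schattenNorm p)) : CompleteSpace h.Space := by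
  refine Metric.complete_of_cauchySeq_tendsto fun s hs => ?_
  have hN : ∀ x y : h.Space, dist x y = schattenNorm p (h.incl x - h.incl y) := fun x y => by
    rw [dist_eq_norm]; rfl
  have hB : ∀ x y : h.Space, SchattenBound p (h.incl x - h.incl y) (dist x y) := fun x y => by
    rw [hN]; exact schattenBound_schattenNorm hp (x - y).2
  have hc : CauchySeq fun n => h.incl (s n) := by
    rw [Metric.cauchySeq_iff'] at hs ⊢
    intro ε hε
    obtain ⟨N, hNs⟩ := hs ε hε
    refine ⟨N, fun n hn => lt_of_le_of_lt ?_ (hNs n hn)⟩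
    rw [dist_eq_norm]
    exact (hB _ _).norm_le hp dist_nonneg
  obtain ⟨A, hA⟩ := cauchySeq_tendsto_of_complete hc
  have key : ∀ ε, 0 < ε → ∃ N, ∀ n ≥ N, SchattenBound p (A - h.incl (s n)) ε := by
    intro ε hε
    obtain ⟨N, hNs⟩ := Metric.cauchySeq_iff.mp hs ε hε
    refine ⟨N, fun n hn => SchattenBound.of_tendsto hp (hA.sub_const _) ?_⟩
    filter_upwards [eventually_ge_atTop N] with m hm
    exact (hB _ _).mono hp dist_nonneg (hNs m hm n hn).le
  have hmem : A ∈ schattenClass H p := by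
    obtain ⟨N, hN1⟩ := key 1 one_pos
    have := h.add_mem ((hN1 N le_rfl).mem_schattenClass hp) (s N).2
    convert this using 1
    exact (sub_add_cancel A (h.incl (s N))).symm
  obtain ⟨a, rfl⟩ : ∃ a : h.Space, h.incl a = A := ⟨⟨A, hmem⟩, rfl⟩
  refine ⟨a, Metric.tendsto_atTop.mpr fun ε hε => ?_⟩
  obtain ⟨N, hN1⟩ := key (ε / 2) (half_pos hε)
  refine ⟨N, fun n hn => ?_⟩
  rw [dist_comm, hN]
  exact lt_of_le_of_lt ((hN1 n hn).schattenNorm_le hp (half_pos hε).le) (half_lt_self hε)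

theorem eq_of_schattenNorm_add_eq_two (hp : 1 < p) (hA : A ∈ schattenClass H p)
    (hB : B ∈ schattenClass H p) (hA1 : schattenNorm p A = 1) (hB1 : schattenNorm p B = 1)
    (hAB : schattenNorm p (A + B) = 2) : A = B := by
  obtain ⟨ι, e, f, s, hC, -, hs, -, hsum⟩ :=
    exists_isSVD_of_mem hp ((isNormedSubspace_schattenClass hp).add_mem hA hB)
  rw [hAB] at hsum
  have hle : ∀ T : H →L[ℂ] H, T ∈ schattenClass H p → schattenNorm p T = 1 → ∀ J : Finset ι,
      ∑ j ∈ J, ‖inner ℂ (f j) (T (e j))‖ ^ p ≤ 1 := fun T hT hT1 J => by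
    have := (schattenBound_schattenNorm hp hT).sum_le hC.left hC.right J
    rwa [hT1, Real.one_rpow] at this
  have hadd : ∀ j, inner ℂ (f j) (A (e j)) + inner ℂ (f j) (B (e j)) = (s j : ℂ) := fun j => by
    rw [← inner_add_right, ← add_apply, hs]
  have heq : (fun j => inner ℂ (f j) (A (e j))) = fun j => inner ℂ (f j) (B (e j)) := by
    refine eq_of_hasSum_norm_add_rpow hp (hle A hA hA1) (hle B hB hB1) ?_
    convert hsum using 2 with j
    rw [hadd, Complex.norm_real, Real.norm_of_nonneg (hC.nonneg j)]
  have hdiag : ∀ T : H →L[ℂ] H, T ∈ schattenClass H p → schattenNorm p T = 1 →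
      (∀ j, inner ℂ (f j) (T (e j)) = inner ℂ (f j) (A (e j))) → ∀ j,
      T (e j) = inner ℂ (f j) (A (e j)) • f j := fun T hT hT1 hTA j => by
    obtain ⟨κ, u, v, a, hTs, -, -, -, hTsum⟩ := exists_isSVD_of_mem hp hT
    -- The two diagonals are equal and add up to `s`, so each is `s / 2`, of `ℓ^p`-norm one: the
    -- equality case applies to `T`.
    have hS : HasSum (fun j => ‖inner ℂ (f j) (T (e j))‖ ^ p) 1 := by
      have h1 := hsum.div_const (2 ^ p)
      rw [div_self (by positivity)] at h1
      have h2 : ∀ j, s j ^ p / 2 ^ p = ‖inner ℂ (f j) (T (e j))‖ ^ p := fun j => by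
        have h3 := hadd j
        rw [← congrFun heq j, ← hTA, ← two_mul] at h3
        have h4 := congrArg norm h3
        rw [norm_mul, Complex.norm_real, Real.norm_of_nonneg (hC.nonneg j), Complex.norm_two] at h4
        rw [← Real.div_rpow (hC.nonneg j) (by norm_num), ← h4, mul_div_cancel_left₀ _ (by norm_num)]
      simpa only [h2] using h1
    rw [hT1, Real.one_rpow] at hTsum
    have h4 := hTs.apply_eq_inner_smul hp hTsum.summable hC.left hC.right hS hTsum.tsum_eq.le j
    rwa [hTA] at h4
  have h5 : ∀ j, A (e j) = B (e j) := fun j => by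
    rw [hdiag A hA hA1 (fun _ => rfl), hdiag B hB hB1 fun j => (congrFun heq j).symm]
  ext x
  have h6 := (e.hasSum_repr x).mapL A
  have h7 := (e.hasSum_repr x).mapL B
  simp only [map_smul, h5] at h6 h7
  exact h6.unique h7

theorem isStrictlyConvex_schattenClass (hp : 1 < p) :
    IsStrictlyConvex ℂ (schattenClass H p) (schattenNorm p) := by
  refine ⟨isNormedSubspace_schattenClass hp, ?_⟩
  let _ : NormedSpace ℝ (isNormedSubspace_schattenClass (H := H) hp).Space :=
    NormedSpace.restrictScalars ℝ ℂ _
  refine StrictConvexSpace.of_norm_add_ne_two fun x y hx hy hxy h => hxy ?_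
  exact Subtype.ext (eq_of_schattenNorm_add_eq_two hp x.2 y.2 hx hy h)

/-- In an eigenbasis of `A` the eigenvalues satisfy `aᵢ = ⟪uᵢ, A uᵢ⟫ ≤ Re ⟪uᵢ, B uᵢ⟫`, and the
diagonal of `B` is controlled by its norm. -/
theorem schattenNorm_mono (hp : 1 < p) (hA : A ∈ schattenClass H p) (hB : B ∈ schattenClass H p)
    (h0 : 0 ≤ A) (hAB : A ≤ B) : schattenNorm p A ≤ schattenNorm p B := by
  obtain ⟨ι, u, v, a, h, -, -, h3, h4⟩ := exists_isSVD_of_mem hp hA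
  rw [← Real.rpow_le_rpow_iff (schattenNorm_nonneg p A) (schattenNorm_nonneg p B)
    (by linarith : 0 < p)]
  refine hasSum_le_of_sum_le h4 fun s => ?_
  refine le_trans (Finset.sum_le_sum fun i _ => ?_)
    ((schattenBound_schattenNorm hp hB).sum_le h.left h.left s)
  refine Real.rpow_le_rpow (h.nonneg i) ?_ (by linarith)
  have h5 : 0 ≤ (inner ℂ (u i) ((B - A) (u i))).re :=
    ((ContinuousLinearMap.le_def A B).mp hAB).re_inner_nonneg_right (u i)
  have h6 : inner ℂ (u i) (A (u i)) = (a i : ℂ) := by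
    rw [h3 h0, inner_smul_right, inner_self_eq_norm_sq_to_K, u.orthonormal.1]
    simp
  rw [sub_apply, inner_sub_right, h6, Complex.sub_re, Complex.ofReal_re] at h5
  exact (by linarith : a i ≤ _).trans (Complex.re_le_norm _)

end SchattenSpace

/-! ### Trace duality and reflexivity -/

section Reflexive

universe u
variable {H : Type u} [NormedAddCommGroup H] [InnerProductSpace ℂ H]
  {A : H →L[ℂ] H} {p q C : ℝ}

theorem exists_phase (x : ℂ) : ∃ w : ℂ, ‖w‖ = 1 ∧ w * x = ‖x‖ := by
  by_cases hx : x = 0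
  · exact ⟨1, by simp, by simp [hx]⟩
  · have hx' : (‖x‖ : ℂ) ≠ 0 := by exact_mod_cast norm_ne_zero_iff.mpr hx
    refine ⟨‖x‖ / x, ?_, div_mul_cancel₀ _ hx⟩
    rw [norm_div, Complex.norm_real, norm_norm, div_self (norm_ne_zero_iff.mpr hx)]

theorem IsBessel.smul {ι : Type*} {v : ι → H} (hv : IsBessel v) {w : ι → ℂ}
    (hw : ∀ i, ‖w i‖ = 1) : IsBessel fun i => w i • v i := fun s y => by
  simpa only [inner_smul_left, norm_mul, RCLike.norm_conj, hw, one_mul] using hv s y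

theorem le_rpow_of_le_mul_rpow (hpq : p.HolderConjugate q) {S N : ℝ} (hS : 0 ≤ S) (hN : 0 ≤ N)
    (h : S ≤ N * S ^ (1 / q)) : S ≤ N ^ p := by
  rcases hS.eq_or_lt with rfl | hS
  · positivity
  have e : S = S ^ (1 / p) * S ^ (1 / q) := by
    rw [← Real.rpow_add hS, one_div, one_div, hpq.inv_add_inv_eq_one, Real.rpow_one]
  have h1 : S ^ (1 / p) ≤ N := by
    refine le_of_mul_le_mul_right ?_ (by positivity : 0 < S ^ (1 / q))
    rwa [← e]
  have h2 := Real.rpow_le_rpow (by positivity) h1 hpq.nonneg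
  rwa [← Real.rpow_mul hS.le, one_div_mul_cancel hpq.ne_zero, Real.rpow_one] at h2

theorem SchattenBound.adjoint [CompleteSpace H] (h : SchattenBound p A C) :
    SchattenBound p (ContinuousLinearMap.adjoint A) C := fun n x y hx hy => by
  refine le_trans (le_of_eq (Finset.sum_congr rfl fun j _ => ?_)) (h n y x hy hx)
  rw [ContinuousLinearMap.adjoint_inner_right, norm_inner_symm]

/-- A functional on a space in which finite sums of elementary tensors satisfy an `ℓ^q`-estimate is
represented by an operator with `ℓ^p`-bounded diagonals. -/
theorem exists_operator_of_dual [CompleteSpace H] (hpq : p.HolderConjugate q) {Y : Type*}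
    [NormedAddCommGroup Y] [NormedSpace ℂ Y] (L : H →ₗ⋆[ℂ] H →ₗ[ℂ] Y)
    (hL : ∀ y x, ‖L y x‖ ≤ ‖y‖ * ‖x‖)
    (hLs : ∀ (n : ℕ) (x y : Fin n → H) (a : Fin n → ℝ), IsBessel x → IsBessel y → (∀ j, 0 ≤ a j) →
      ‖∑ j, (a j : ℂ) • L (x j) (y j)‖ ≤ (∑ j, a j ^ q) ^ (1 / q)) (Ψ : StrongDual ℂ Y) :
    ∃ G : H →L[ℂ] H, (∀ y x, inner ℂ (G y) x = Ψ (L y x)) ∧ SchattenBound p G ‖Ψ‖ := by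
  set B : H →L⋆[ℂ] H →L[ℂ] ℂ := LinearMap.mkContinuous₂ (LinearMap.mk₂'ₛₗ (starRingEnd ℂ)
    (RingHom.id ℂ) (fun y x => Ψ (L y x)) (fun _ _ _ => by simp) (fun _ _ _ => by simp)
    (fun _ _ _ => by simp) (fun _ _ _ => by simp)) ‖Ψ‖ (fun y x => by
      rw [LinearMap.mk₂'ₛₗ_apply, mul_assoc]
      exact (Ψ.le_opNorm _).trans (mul_le_mul_of_nonneg_left (hL y x) (norm_nonneg _)))
  have hB : ∀ y x, B y x = Ψ (L y x) := fun y x => rfl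
  refine ⟨InnerProductSpace.continuousLinearMapOfBilin B, fun y x => by
    rw [InnerProductSpace.continuousLinearMapOfBilin_apply, hB], fun n x y hx hy => ?_⟩
  set t : Fin n → ℝ := fun j => ‖Ψ (L (x j) (y j))‖ with ht
  have e : ∀ j, ‖inner ℂ (y j) (InnerProductSpace.continuousLinearMapOfBilin B (x j))‖ = t j :=
    fun j => by
      rw [norm_inner_symm, InnerProductSpace.continuousLinearMapOfBilin_apply, hB]
  simp_rw [e]
  choose w hw1 hw using fun j => exists_phase (Ψ (L (x j) (y j)))
  -- These coefficients are extremal in Hölder's inequality: `Ψ` takes the value `∑ tⱼ ^ p`, while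
  -- `(p - 1) * q = p` makes the `ℓ^q`-norm equal to `(∑ tⱼ ^ p) ^ (1 / q)`.
  have h1 := hLs n x (fun j => w j • y j) (fun j => t j ^ (p - 1)) hx (hy.smul hw1)
    (fun j => Real.rpow_nonneg (norm_nonneg _) _)
  have h2 : Ψ (∑ j, ((t j ^ (p - 1) : ℝ) : ℂ) • L (x j) (w j • y j)) = ((∑ j, t j ^ p : ℝ) : ℂ) := by
    rw [map_sum, Complex.ofReal_sum]
    refine Finset.sum_congr rfl fun j _ => ?_
    rw [map_smul, map_smul, map_smul, smul_eq_mul, smul_eq_mul, hw, ← Complex.ofReal_mul]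
    congr 1
    change t j ^ (p - 1) * t j = t j ^ p
    have ht0 : 0 ≤ t j := norm_nonneg _
    rcases ht0.eq_or_lt with h0 | h0
    · rw [← h0, Real.zero_rpow hpq.ne_zero, mul_zero]
    · rw [← Real.rpow_add_one h0.ne']; ring_nf
  have h3 : ∀ j, (t j ^ (p - 1)) ^ q = t j ^ p := fun j => by
    rw [← Real.rpow_mul (norm_nonneg _), hpq.sub_one_mul_conj]
  simp_rw [h3] at h1
  have hS : 0 ≤ ∑ j, t j ^ p := Finset.sum_nonneg fun j _ => Real.rpow_nonneg (norm_nonneg _) _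
  refine le_rpow_of_le_mul_rpow hpq hS (norm_nonneg Ψ) ?_
  have h4 := Ψ.le_opNorm (∑ j, ((t j ^ (p - 1) : ℝ) : ℂ) • L (x j) (w j • y j))
  rw [h2, Complex.norm_real, Real.norm_of_nonneg hS] at h4
  exact h4.trans (mul_le_mul_of_nonneg_left h1 (norm_nonneg _))

theorem isSVD_sum {n : ℕ} {x y : Fin n → H} {a : Fin n → ℝ} (hx : IsBessel x) (hy : IsBessel y)
    (ha : ∀ j, 0 ≤ a j) :
    IsSVD (∑ j, (a j : ℂ) • InnerProductSpace.rankOne ℂ (y j) (x j)) x y a where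
  left := hx
  right := hy
  nonneg := ha
  hasSum z := by
    convert hasSum_fintype _ using 1
    rw [sum_apply]
    refine Finset.sum_congr rfl fun j _ => ?_
    rw [smul_apply, InnerProductSpace.rankOne_apply, smul_smul]

theorem schattenBound_sum (hp : 1 < p) {n : ℕ} {x y : Fin n → H} {a : Fin n → ℝ} (hx : IsBessel x)
    (hy : IsBessel y) (ha : ∀ j, 0 ≤ a j) :
    SchattenBound p (∑ j, (a j : ℂ) • InnerProductSpace.rankOne ℂ (y j) (x j))
      ((∑ j, a j ^ p) ^ (1 / p)) := by
  refine (isSVD_sum hx hy ha).schattenBound hp (hasSum_fintype _).summable ?_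
  rw [tsum_fintype, ← Real.rpow_mul (Finset.sum_nonneg fun j _ => Real.rpow_nonneg (ha j) _),
    one_div_mul_cancel (by linarith), Real.rpow_one]

theorem schattenBound_rankOne (hp : 1 < p) (x y : H) :
    SchattenBound p (InnerProductSpace.rankOne ℂ x y) (‖y‖ * ‖x‖) := by
  by_cases hx : x = 0
  · simpa [hx] using SchattenBound.zero (H := H) hp
  by_cases hy : y = 0
  · simpa [hy] using SchattenBound.zero (H := H) hp
  have h1 : ∀ z : H, z ≠ 0 → IsBessel (fun _ : Fin 1 => ((‖z‖⁻¹ : ℝ) : ℂ) • z) := fun z hz =>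
    Orthonormal.isBessel ⟨fun _ => by
      rw [norm_smul, Complex.norm_real, norm_inv, norm_norm,
        inv_mul_cancel₀ (norm_ne_zero_iff.mpr hz)],
      fun i j hij => absurd (Subsingleton.elim i j) hij⟩
  have h2 := (schattenBound_sum hp (h1 y hy) (h1 x hx) (a := fun _ => 1)
    (fun _ => zero_le_one)).smul (by positivity) ((‖y‖ * ‖x‖ : ℝ) : ℂ)
  convert h2 using 1
  · have hx' : (‖x‖ : ℂ) ≠ 0 := by exact_mod_cast norm_ne_zero_iff.mpr hx
    have hy' : (‖y‖ : ℂ) ≠ 0 := by exact_mod_cast norm_ne_zero_iff.mpr hy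
    ext z
    simp only [Finset.univ_unique, Finset.sum_singleton, smul_apply,
      InnerProductSpace.rankOne_apply, inner_smul_left, Complex.conj_ofReal, smul_smul]
    congr 1
    push_cast
    field_simp
  · simp

theorem hasSum_ite_mem_finset {ι M : Type*} [DecidableEq ι] [AddCommMonoid M] [TopologicalSpace M]
    (f : ι → M) (J : Finset ι) : HasSum (fun i => if i ∈ J then f i else 0) (∑ i ∈ J, f i) := by
  have h := hasSum_sum_of_ne_finset_zero (L := .unconditional ι)
    (f := fun i => if i ∈ J then f i else 0) (s := J) fun i hi => if_neg hi
  rwa [Finset.sum_congr rfl fun i hi => if_pos hi] at h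

/-- The partial sums of the singular value decomposition converge in the Schatten class. -/
theorem IsSVD.exists_tendsto_schattenBound {ι : Type*} {u v : ι → H} {a : ι → ℝ}
    (hA : IsSVD A u v a) (hp : 1 < p) (hs : Summable fun i => a i ^ p) :
    ∃ r : Finset ι → ℝ, Tendsto r atTop (𝓝 0) ∧ ∀ J, 0 ≤ r J ∧ SchattenBound p
      (A - ∑ i ∈ J, (a i : ℂ) • InnerProductSpace.rankOne ℂ (v i) (u i)) (r J) := by
  classical
  have hp0 : p ≠ 0 := by linarith
  have h1 : ∀ J : Finset ι, HasSum (fun i => (if i ∈ J then 0 else a i) ^ p)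
      (∑' i, a i ^ p - ∑ i ∈ J, a i ^ p) := fun J => by
    have h2 := hs.hasSum.sub (hasSum_ite_mem_finset (fun i => a i ^ p) J)
    have e : (fun i => (if i ∈ J then 0 else a i) ^ p) =
        fun i => a i ^ p - if i ∈ J then a i ^ p else 0 := by
      ext i
      split_ifs <;> simp [Real.zero_rpow hp0]
    rwa [e]
  have h0 : ∀ J : Finset ι, 0 ≤ ∑' i, a i ^ p - ∑ i ∈ J, a i ^ p := fun J =>
    sub_nonneg.mpr (hs.sum_le_tsum J fun i _ => Real.rpow_nonneg (hA.nonneg i) p)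
  refine ⟨fun J => (∑' i, a i ^ p - ∑ i ∈ J, a i ^ p) ^ (1 / p), ?_, fun J =>
    ⟨Real.rpow_nonneg (h0 J) _, ?_⟩⟩
  · have h2 := (tendsto_const_nhds (x := ∑' i, a i ^ p)).sub hs.hasSum
    rw [sub_self] at h2
    have h3 := h2.rpow_const (p := 1 / p) (Or.inr (by positivity))
    rwa [Real.zero_rpow (by positivity)] at h3
  -- Subtracting the partial sum sets the singular values in `J` to zero, so the remainder is
  -- bounded by an `ℓ^p`-tail.
  · have hT : IsSVD (A - ∑ i ∈ J, (a i : ℂ) • InnerProductSpace.rankOne ℂ (v i) (u i)) u v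
        (fun i => if i ∈ J then 0 else a i) := by
      refine ⟨hA.left, hA.right, fun i => ?_, fun x => ?_⟩
      · split_ifs
        · exact le_rfl
        · exact hA.nonneg i
      · have h2 := (hA.hasSum x).sub
          (hasSum_ite_mem_finset (fun i => ((a i : ℂ) * inner ℂ (u i) x) • v i) J)
        have e : (fun i => (((if i ∈ J then 0 else a i : ℝ) : ℂ) * inner ℂ (u i) x) • v i) =
            fun i => ((a i : ℂ) * inner ℂ (u i) x) • v i -
              if i ∈ J then ((a i : ℂ) * inner ℂ (u i) x) • v i else 0 := by
          ext i
          split_ifs <;> simp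
        rw [e]
        simpa only [sub_apply, sum_apply, smul_apply, InnerProductSpace.rankOne_apply,
          smul_smul] using h2
    refine hT.schattenBound hp (h1 J).summable ?_
    rw [(h1 J).tsum_eq, ← Real.rpow_mul (h0 J), one_div_mul_cancel hp0, Real.rpow_one]

variable [CompleteSpace H]

/-- The elementary tensors `|x⟩⟨y|` in a Schatten class. -/
noncomputable def rankOneSchatten (hp : 1 < p)
    (h : IsNormedSubspace ℂ (schattenClass H p) (schattenNorm p)) :
    H →ₗ⋆[ℂ] H →ₗ[ℂ] h.Space :=
  LinearMap.mk₂'ₛₗ (starRingEnd ℂ) (RingHom.id ℂ)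
    (fun y x => (⟨InnerProductSpace.rankOne ℂ x y,
      (schattenBound_rankOne hp x y).mem_schattenClass hp⟩ : h.toSubmodule))
    (fun y y' x => Subtype.ext (map_add (InnerProductSpace.rankOne ℂ x) y y'))
    (fun c y x => Subtype.ext (map_smulₛₗ (InnerProductSpace.rankOne ℂ x) c y))
    (fun y x x' => Subtype.ext (congrArg (fun T : H →L⋆[ℂ] H →L[ℂ] H => T y)
      (map_add (InnerProductSpace.rankOne ℂ) x x')))
    (fun c y x => Subtype.ext (congrArg (fun T : H →L⋆[ℂ] H →L[ℂ] H => T y)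
      (map_smul (InnerProductSpace.rankOne ℂ) c x)))

theorem norm_inner_incl_le (hp : 1 < p)
    (h : IsNormedSubspace ℂ (schattenClass H p) (schattenNorm p)) (y x : H) (T : h.Space) :
    ‖inner ℂ y (h.incl T x)‖ ≤ ‖y‖ * ‖x‖ * ‖T‖ := by
  refine ((schattenBound_schattenNorm hp T.2).norm_inner_le hp
    (schattenNorm_nonneg _ _) x y).trans (le_of_eq ?_)
  rw [mul_assoc, mul_comm, mul_comm ‖x‖]; rfl

/-- The functionals `T ↦ ⟪y, T x⟫` on a Schatten class. -/
noncomputable def innerFunctional (hp : 1 < p)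
    (h : IsNormedSubspace ℂ (schattenClass H p) (schattenNorm p)) :
    H →ₗ⋆[ℂ] H →ₗ[ℂ] StrongDual ℂ h.Space :=
  LinearMap.mk₂'ₛₗ (starRingEnd ℂ) (RingHom.id ℂ)
    (fun y x => LinearMap.mkContinuous
      { toFun := fun T : h.Space => inner ℂ y (h.incl T x)
        map_add' := fun S T => inner_add_right y (h.incl S x) (h.incl T x)
        map_smul' := fun c T => inner_smul_right y (h.incl T x) c } (‖y‖ * ‖x‖)
      fun T => norm_inner_incl_le hp h y x T)
    (fun _ _ _ => by ext; exact inner_add_left _ _ _)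
    (fun _ _ _ => by ext; exact inner_smul_left _ _ _)
    (fun _ _ _ => by ext T; exact (congrArg _ (map_add (h.incl T) _ _)).trans (inner_add_right _ _ _))
    (fun _ _ _ => by ext T; exact (congrArg _ (map_smul (h.incl T) _ _)).trans (inner_smul_right _ _ _))

theorem innerFunctional_apply (hp : 1 < p)
    (h : IsNormedSubspace ℂ (schattenClass H p) (schattenNorm p))
    (y x : H) (T : h.Space) :
    innerFunctional hp h y x T = inner ℂ y (h.incl T x) := rfl

theorem incl_rankOneSchatten (hp : 1 < p)
    (h : IsNormedSubspace ℂ (schattenClass H p) (schattenNorm p))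
    (y x : H) :
    h.incl (rankOneSchatten hp h y x) = InnerProductSpace.rankOne ℂ x y := rfl

theorem incl_sum
    (h : IsNormedSubspace ℂ (schattenClass H p) (schattenNorm p))
    {ι : Type*} (s : Finset ι) (f : ι → h.Space) :
    h.incl (∑ i ∈ s, f i) = ∑ i ∈ s, h.incl (f i) :=
  map_sum h.toSubmodule.subtype f s

theorem hasSum_rankOneSchatten (hp : 1 < p)
    (h : IsNormedSubspace ℂ (schattenClass H p) (schattenNorm p))
    {ι : Type*} {u v : ι → H} {a : ι → ℝ} (T : h.Space)
    (hT : IsSVD (h.incl T) u v a) (hs : Summable fun i => a i ^ p) :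
    HasSum (fun i => (a i : ℂ) • rankOneSchatten hp h (u i) (v i)) T := by
  obtain ⟨r, hr, hrJ⟩ := hT.exists_tendsto_schattenBound hp hs
  rw [HasSum, tendsto_iff_norm_sub_tendsto_zero]
  refine squeeze_zero (fun _ => norm_nonneg _) (fun J => ?_) hr
  rw [norm_sub_rev]
  have := (hrJ J).2.schattenNorm_le hp (hrJ J).1
  refine le_trans (le_of_eq ?_) this
  change schattenNorm p (h.incl T - h.incl (∑ i ∈ J, (a i : ℂ) • rankOneSchatten hp h (u i) (v i))) = _
  rw [incl_sum]
  rfl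

/-- A functional is bounded by the Schatten bound of the operator that represents it. -/
theorem norm_le_of_schattenBound (hp : 1 < p)
    (h : IsNormedSubspace ℂ (schattenClass H p) (schattenNorm p))
    (hpq : p.HolderConjugate q) (φ : StrongDual ℂ h.Space)
    {G : H →L[ℂ] H} (hG : ∀ y x, inner ℂ (G y) x = φ (rankOneSchatten hp h y x)) (hC : 0 ≤ C)
    (hGC : SchattenBound q G C) : ‖φ‖ ≤ C := by
  refine φ.opNorm_le_bound hC fun T => ?_
  obtain ⟨ι, u, v, a, hT, -, -, -, hs⟩ := exists_isSVD_of_mem hp T.2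
  have h1 := ((hasSum_rankOneSchatten hp h T hT hs.summable).mapL φ).norm
  refine le_of_tendsto h1 (Eventually.of_forall fun J => ?_)
  simp only [map_smul, ← hG]
  refine (norm_sum_le _ _).trans ?_
  simp only [norm_smul, Complex.norm_real]
  have h2 := Real.inner_le_Lp_mul_Lq J (fun i => ‖a i‖) (fun i => ‖inner ℂ (G (u i)) (v i)‖) hpq
  refine h2.trans ?_
  simp only [abs_norm]
  simp_rw [fun i => Real.norm_of_nonneg (hT.nonneg i)]
  rw [mul_comm C]
  refine mul_le_mul ?_ ?_ (by positivity) (norm_nonneg _)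
  · have h3 := sum_le_hasSum J (fun i _ => Real.rpow_nonneg (hT.nonneg i) p) hs
    have h4 := Real.rpow_le_rpow (z := 1 / p)
      (Finset.sum_nonneg fun i _ => Real.rpow_nonneg (hT.nonneg i) p) h3 (by positivity)
    rwa [← Real.rpow_mul (schattenNorm_nonneg _ _), mul_one_div_cancel hpq.ne_zero,
      Real.rpow_one] at h4
  · have h3 := hGC.sum_le hT.left hT.right J
    simp_rw [norm_inner_symm (v _)] at h3
    have h4 := Real.rpow_le_rpow (z := 1 / q) (by positivity) h3 hpq.symm.one_div_nonneg
    rwa [← Real.rpow_mul hC, mul_one_div_cancel hpq.symm.ne_zero, Real.rpow_one] at h4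

/-- The functionals `T ↦ ⟪y, T x⟫` have dense span in the dual of a Schatten class. -/
theorem exists_hasSum_innerFunctional (hp : 1 < p)
    (h : IsNormedSubspace ℂ (schattenClass H p) (schattenNorm p))
    (φ : StrongDual ℂ h.Space) :
    ∃ (ι : Type u) (u v : ι → H) (b : ι → ℂ),
      HasSum (fun i => b i • innerFunctional hp h (v i) (u i)) φ := by
  have hpq := Real.HolderConjugate.conjExponent hp
  set q := p.conjExponent
  -- The exponents are exchanged: elementary tensors satisfy an `ℓ^p`-estimate, so `G` is
  -- `q`-bounded. Truncating its decomposition approximates `φ` in the dual norm.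
  obtain ⟨G, hG, hGφ⟩ := exists_operator_of_dual hpq.symm (rankOneSchatten hp h)
    (fun y x => (schattenBound_rankOne hp x y).schattenNorm_le hp (by positivity))
    (fun n x y a hx hy ha => by
      refine le_trans (le_of_eq ?_) ((schattenBound_sum hp hx hy ha).schattenNorm_le hp
        (Real.rpow_nonneg (Finset.sum_nonneg fun j _ => Real.rpow_nonneg (ha j) _) _))
      change schattenNorm p (h.incl (∑ j, (a j : ℂ) • rankOneSchatten hp h (x j) (y j))) = _
      rw [incl_sum]
      rfl) φ
  have hq : 1 < q := hpq.symm.lt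
  obtain ⟨ι, u, v, a, hGs, -, -, -, hs⟩ := exists_isSVD_of_mem hq (hGφ.mem_schattenClass hq)
  refine ⟨ι, u, v, fun i => a i, ?_⟩
  obtain ⟨r, hr, hrJ⟩ := hGs.exists_tendsto_schattenBound hq hs.summable
  rw [HasSum, tendsto_iff_norm_sub_tendsto_zero]
  refine squeeze_zero (fun _ => norm_nonneg _) (fun J => ?_) hr
  rw [norm_sub_rev]
  refine norm_le_of_schattenBound hp h hpq _ (fun y x => ?_) (hrJ J).1 (hrJ J).2
  rw [sub_apply, sub_apply, inner_sub_left, hG, sum_apply, sum_apply, sum_inner]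
  congr 1
  refine Finset.sum_congr rfl fun i _ => ?_
  rw [smul_apply, smul_apply, InnerProductSpace.rankOne_apply, innerFunctional_apply,
    incl_rankOneSchatten, InnerProductSpace.rankOne_apply, inner_smul_left, inner_smul_left,
    inner_smul_right, inner_conj_symm, Complex.conj_ofReal, smul_eq_mul]

/-- Restricting `Ψ` to the functionals `T ↦ ⟪y, T x⟫` gives a `p`-bounded operator `G`. Evaluation
at its adjoint agrees with `Ψ` on these functionals, hence on the whole dual by density and
continuity. -/
theorem isReflexiveSpace_schattenClass (hp : 1 < p)
    (h : IsNormedSubspace ℂ (schattenClass H p) (schattenNorm p))  : IsReflexiveSpace ℂ h.Space := by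
  intro Ψ
  have hpq := Real.HolderConjugate.conjExponent hp
  set q := p.conjExponent
  obtain ⟨G, hG, hGΨ⟩ := exists_operator_of_dual hpq (innerFunctional hp h)
    (fun y x => ContinuousLinearMap.opNorm_le_bound _ (by positivity)
      fun T => norm_inner_incl_le hp h y x T)
    (fun n x y a hx hy ha => by
      refine ContinuousLinearMap.opNorm_le_bound _
        (Real.rpow_nonneg (Finset.sum_nonneg fun j _ => Real.rpow_nonneg (ha j) _) _) fun T => ?_
      rw [sum_apply]
      simp only [smul_apply, innerFunctional_apply]
      refine (norm_sum_le _ _).trans ?_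
      simp only [norm_smul, Complex.norm_real]
      refine (Real.inner_le_Lp_mul_Lq Finset.univ (fun j => ‖a j‖)
        (fun j => ‖inner ℂ (x j) (h.incl T (y j))‖) hpq.symm).trans ?_
      simp only [abs_norm]
      simp_rw [fun i => Real.norm_of_nonneg (ha i)]
      refine mul_le_mul_of_nonneg_left ?_
        (Real.rpow_nonneg (Finset.sum_nonneg fun j _ => Real.rpow_nonneg (ha j) _) _)
      have h3 := schattenBound_schattenNorm hp T.2 n y x hy hx
      have h4 := Real.rpow_le_rpow (z := 1 / p) (by positivity) h3 hpq.one_div_nonneg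
      rwa [← Real.rpow_mul (schattenNorm_nonneg _ _), mul_one_div_cancel hpq.ne_zero,
        Real.rpow_one] at h4) Ψ
  obtain ⟨T, hT⟩ : ∃ T : h.Space, h.incl T = ContinuousLinearMap.adjoint G :=
    ⟨⟨_, hGΨ.adjoint.mem_schattenClass hp⟩, rfl⟩
  refine ⟨T, ?_⟩
  ext φ
  obtain ⟨ι, u, v, b, hφ⟩ := exists_hasSum_innerFunctional hp h φ
  rw [NormedSpace.dual_def]
  have h1 := hφ.mapL Ψ
  have h2 := hφ.mapL (ContinuousLinearMap.apply ℂ ℂ T)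
  have e : ∀ i, ContinuousLinearMap.apply ℂ ℂ T (b i • innerFunctional hp h (v i) (u i)) =
      Ψ (b i • innerFunctional hp h (v i) (u i)) := fun i => by
    rw [map_smul, map_smul, ← hG, ContinuousLinearMap.apply_apply, innerFunctional_apply, hT,
      ContinuousLinearMap.adjoint_inner_right]
  simp only [e] at h2
  exact h2.unique h1

theorem isReflexiveBanach_schattenClass (hp : 1 < p) :
    IsReflexiveBanach ℂ (schattenClass H p) (schattenNorm p) :=
  ⟨isNormedSubspace_schattenClass hp, completeSpace_schattenClass hp _,
    isReflexiveSpace_schattenClass hp _⟩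

end Reflexive

/-! ### Operator order and the graph relation -/

variable {H : Type*} [NormedAddCommGroup H] [InnerProductSpace ℂ H]

theorem le_of_tendsto_of_le {u ψ : H →L[ℂ] H} {us : ℕ → H →L[ℂ] H} (hu : Tendsto us atTop (𝓝 u))
    (h : ∀ i, us i ≤ ψ) : u ≤ ψ := by
  have h1 : ∀ x, Tendsto (fun i => (ψ - us i) x) atTop (𝓝 ((ψ - u) x)) := fun x =>
    ((ContinuousLinearMap.apply ℂ H x).continuous.tendsto _).comp (hu.const_sub ψ)
  rw [ContinuousLinearMap.le_def, ContinuousLinearMap.isPositive_def]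
  have h2 := fun i => ContinuousLinearMap.isPositive_def.mp
    ((ContinuousLinearMap.le_def (us i) ψ).mp (h i))
  refine ⟨fun x y => ?_, fun x => ?_⟩
  · exact tendsto_nhds_unique ((h1 x).inner tendsto_const_nhds)
      ((tendsto_const_nhds.inner (h1 y)).congr fun i => ((h2 i).1 x y).symm)
  · exact ge_of_tendsto' ((Complex.continuous_re.tendsto _).comp ((h1 x).inner tendsto_const_nhds))
      fun i => (h2 i).2 x

theorem mem_graphRel {D : Submodule ℂ (H →L[ℂ] H)} {T : D →ₗ[ℂ] (H →L[ℂ] H)}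
    {u g : H →L[ℂ] H} : (u, g) ∈ graphRel D T ↔ ∃ A : D, (A : H →L[ℂ] H) = u ∧ T A = g :=
  exists_congr fun _ => Prod.ext_iff

theorem isGradientRelation_graphRel (D : Submodule ℂ (H →L[ℂ] H)) (T : D →ₗ[ℂ] (H →L[ℂ] H)) :
    IsGradientRelation ℂ ℂ (graphRel D T) where
  add_mem := by
    intro u u' g g' h h'
    obtain ⟨A, rfl, rfl⟩ := mem_graphRel.mp h
    obtain ⟨B, rfl, rfl⟩ := mem_graphRel.mp h'
    exact ⟨A + B, Prod.ext rfl (map_add T A B)⟩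
  smul_mem := by
    intro u g α _ h
    obtain ⟨A, rfl, rfl⟩ := mem_graphRel.mp h
    exact ⟨(α : ℂ) • A, Prod.ext rfl (map_smul T _ A)⟩

variable [CompleteSpace H]

theorem tendsto_of_tendsto_schattenNorm {p : ℝ} (hp : 1 < p) {A : H →L[ℂ] H}
    {As : ℕ → H →L[ℂ] H} (hA : A ∈ schattenClass H p) (hAs : ∀ i, As i ∈ schattenClass H p)
    (h : Tendsto (fun i => schattenNorm p (A - As i)) atTop (𝓝 0)) : Tendsto As atTop (𝓝 A) := by
  rw [tendsto_iff_norm_sub_tendsto_zero]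
  refine squeeze_zero (fun _ => norm_nonneg _) (fun i => ?_) h
  rw [norm_sub_rev]
  refine norm_le_schattenNorm hp ?_
  have hS := isNormedSubspace_schattenClass (H := H) hp
  have h1 := hS.add_mem hA (hS.smul_mem (-1) (hAs i))
  rwa [neg_one_smul, ← sub_eq_add_neg] at h1

theorem isLinearPreorder_le : IsLinearPreorder ℂ (fun A B : H →L[ℂ] H => A ≤ B) where
  refl := le_refl
  trans _ _ _ := le_trans
  add_left _ _ _ h := by gcongr
  smul a b α hα h := by
    change (Complex.ofReal α) • a ≤ (Complex.ofReal α) • b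
    rw [Complex.coe_smul, Complex.coe_smul]
    exact smul_le_smul_of_nonneg_left h hα

/-- Closedness of `D` puts `u` in the domain, and boundedness of `T` makes `gs i` converge to its
image. That image equals `g` because both limits also hold in operator norm. -/
theorem mem_graphRel_of_tendsto {p : ℝ} (hp : 1 < p) {D : Submodule ℂ (H →L[ℂ] H)}
    (hDclosed : ∀ (As : ℕ → (H →L[ℂ] H)) (A : H →L[ℂ] H), (∀ i, As i ∈ D) →
      A ∈ schattenClass H p → Tendsto (fun i => schattenNorm p (A - As i)) atTop (𝓝 0) → A ∈ D)
    {T : D →ₗ[ℂ] (H →L[ℂ] H)} (hT : ∀ A : D, T A ∈ schattenClass H p)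
    {C : ℝ} (hC : ∀ A : D, schattenNorm p (T A) ≤ C * schattenNorm p (A : H →L[ℂ] H))
    {u g : H →L[ℂ] H} {us gs : ℕ → H →L[ℂ] H} (hu : u ∈ schattenClass H p)
    (hg : g ∈ schattenClass H p) (hgs : ∀ i, gs i ∈ schattenClass H p)
    (hR : ∀ i, (us i, gs i) ∈ graphRel D T)
    (htu : Tendsto (fun i => schattenNorm p (u - us i)) atTop (𝓝 0))
    (htg : Tendsto (fun i => schattenNorm p (g - gs i)) atTop (𝓝 0)) :
    (u, g) ∈ graphRel D T := by
  choose A hA using hR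
  have hAu : ∀ i, (A i : H →L[ℂ] H) = us i := fun i => congrArg Prod.fst (hA i)
  have hAg : ∀ i, T (A i) = gs i := fun i => congrArg Prod.snd (hA i)
  obtain ⟨U, rfl⟩ : ∃ U : D, (U : H →L[ℂ] H) = u :=
    ⟨⟨u, hDclosed us u (fun i => hAu i ▸ (A i).2) hu htu⟩, rfl⟩
  refine ⟨U, Prod.ext rfl ?_⟩
  have h0 : ∀ i, schattenNorm p (T U - gs i) ≤ C * schattenNorm p ((U : H →L[ℂ] H) - us i) :=
    fun i => by
      have h := hC (U - A i)
      rwa [map_sub, Submodule.coe_sub, hAg, hAu] at h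
  have h1 : Tendsto (fun i => schattenNorm p (T U - gs i)) atTop (𝓝 0) := by
    have h2 := htu.const_mul C
    rw [mul_zero] at h2
    exact squeeze_zero (fun _ => schattenNorm_nonneg _ _) h0 h2
  exact tendsto_nhds_unique (tendsto_of_tendsto_schattenNorm hp (hT _) hgs h1)
    (tendsto_of_tendsto_schattenNorm hp hg hgs htg)

end GradSp

theorem mainTheorem11 {H : Type*} [NormedAddCommGroup H] [InnerProductSpace ℂ H] [CompleteSpace H]
    [TopologicalSpace.SeparableSpace H] (p : ℝ) (hp : 1 < p)
    (D : Submodule ℂ (H →L[ℂ] H))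
    (hD : ∀ A ∈ D, A ∈ GradSp.schattenClass H p)
    (hDclosed : ∀ (As : ℕ → (H →L[ℂ] H)) (A : H →L[ℂ] H), (∀ i, As i ∈ D) →
      A ∈ GradSp.schattenClass H p →
      Tendsto (fun i => GradSp.schattenNorm p (A - As i)) atTop (𝓝 0) → A ∈ D)
    (T : D →ₗ[ℂ] (H →L[ℂ] H))
    (hT : ∀ A : D, T A ∈ GradSp.schattenClass H p)
    (hTbdd : ∃ C : ℝ, 0 < C ∧
      ∀ A : D, GradSp.schattenNorm p (T A) ≤ C * GradSp.schattenNorm p (A : H →L[ℂ] H)) :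
    GradSp.IsOrderedGradientSpace ℂ ℂ
      (GradSp.schattenClass H p) (GradSp.schattenNorm p)
      (GradSp.schattenClass H p) (GradSp.schattenNorm p)
      (GradSp.graphRel D T)
      (fun A B : H →L[ℂ] H => A ≤ B) where
  gradientRelation := GradSp.isGradientRelation_graphRel D T
  reflexive_left := GradSp.isReflexiveBanach_schattenClass hp
  reflexive_right := GradSp.isReflexiveBanach_schattenClass hp
  strictlyConvex_right := GradSp.isStrictlyConvex_schattenClass hp
  strictlyConvex_left := GradSp.isStrictlyConvex_schattenClass hp
  neg_gradient := by
    intro u _ g _ h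
    obtain ⟨A, rfl, rfl⟩ := GradSp.mem_graphRel.mp h
    exact ⟨T (-A), hT _, ⟨-A, rfl⟩⟩
  closed _ _ _ _ hu _ hg hgs hR htu htg := by
    obtain ⟨C, -, hC⟩ := hTbdd
    exact GradSp.mem_graphRel_of_tendsto hp hDclosed hT hC hu hg hgs hR htu htg
  linearPreorder := GradSp.isLinearPreorder_le
  le_of_tendsto _ _ _ hu hus hle ht :=
    GradSp.le_of_tendsto_of_le (GradSp.tendsto_of_tendsto_schattenNorm hp hu hus ht) hle
  norm_mono _ hu _ hv h0 huv := GradSp.schattenNorm_mono hp hu hv h0 huv
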